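/- Let $n\ge 2$, let $G\subset\mathbb{R}^n$ be an open set, and let $1\le q<\infty$, $0<\delta<1$ and $C>0$. Write $|A|$ for the Lebesgue measure of $A\subset\mathbb R^n$. All integrals below have values in $[0,\infty]$. For a measurable function $u:G\to\mathbb{R}$ put $$|u|_{W^{\delta,1}(G)}=\int_G\int_G\frac{|u(x)-u(y)|}{|x-y|^{n+\delta}}\,dy\,dx .$$ For a compact set $K\subset G$ put $$\mathrm{cap}_{\delta,1}(K,G)=\inf_u |u|_{W^{\delta,1}(G)},$$ where the infimum is taken over all continuous functions $u:G\to\mathbb{R}$ with compact support in $G$ such that $u(x)\ge 1$ for every $x\in K$. For a measurable set $A\subset G$ put $$P_\delta(A,G)=\int_A\int_{G\setminus A}\frac{1}{|x-y|^{n+\delta}}\,dy\,dx .$$ A closed set $\Gamma\subset G$ is called an $(n-1)$-dimensional $C^\infty$-manifold in $G$ if for every $x\in\Gamma$ there are open sets $U\subset\mathbb{R}^{n-1}$ and $V\subset\mathbb{R}$, a smooth function $g:U\to V$ and a rotation $\psi$ of $\mathbb{R}^n$ about the point $x$ such that $x\in\psi(U\times V)$ and $\Gamma\cap\psi(U\times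 V)=\{\psi(y,g(y)) : y\in U\}$. Finally, $D\subset\subset G$ means that the closure of $D$ is compact and contained in $G$. Then the following three conditions (with the same constant $C$) are equivalent. (A) For every measurable function $u:G\to\mathbb{R}$ with compact support in $G$, $$\Big(\int_G|u(x)|^q\,dx\Big)^{1/q}\le C\,|u|_{W^{\delta,1}(G)} .$$ (B) For every compact set $K\subset G$, $$|K|^{1/q}\le C\,\mathrm{cap}_{\delta,1}(K,G) .$$ (C) For every open set $D\subset\subset G$ whose boundary $\partial D$ is an $(n-1)$-dimensional $C^\infty$-manifold in $G$, $$|D|^{1/q}\le 2C\,P_\delta(D,G) .$$ -/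

import Mathlib

open MeasureTheory

open scoped ContDiff

noncomputable section

namespace FracSobolev

/-- The fractional seminorm `|u|_{W^{δ,1}(G)}`, the integral over `x ∈ G` and `y ∈ G` of
`|u(x) - u(y)| / |x - y|^{n+δ}`, with values in `[0, ∞]`. -/
def seminorm {n : ℕ} (δ : ℝ) (G : Set (EuclideanSpace ℝ (Fin n)))
    (u : EuclideanSpace ℝ (Fin n) → ℝ) : ENNReal :=
  ∫⁻ x in G, ∫⁻ y in G, ENNReal.ofReal (|u x - u y| / ‖x - y‖ ^ ((n : ℝ) + δ))

/-- `u` has compact support in `G`. A function on `G` with compact support in `G` is represented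
by its extension by zero to the whole space. -/
def CompactSupportIn {n : ℕ} (G : Set (EuclideanSpace ℝ (Fin n)))
    (u : EuclideanSpace ℝ (Fin n) → ℝ) : Prop :=
  HasCompactSupport u ∧ tsupport u ⊆ G

/-- The fractional capacity `cap_{δ,1}(K, G)`: the infimum of `|u|_{W^{δ,1}(G)}` over the continuous
functions `u` with compact support in the open set `G` such that `u ≥ 1` on `K`. -/
def capacity {n : ℕ} (δ : ℝ) (K G : Set (EuclideanSpace ℝ (Fin n))) : ENNReal :=
  ⨅ u ∈ {u : EuclideanSpace ℝ (Fin n) → ℝ |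
    Continuous u ∧ CompactSupportIn G u ∧ ∀ x ∈ K, 1 ≤ u x}, seminorm δ G u

/-- The fractional perimeter `P_δ(A, G)`, with values in `[0, ∞]`. -/
def perimeter {n : ℕ} (δ : ℝ) (A G : Set (EuclideanSpace ℝ (Fin n))) : ENNReal :=
  ∫⁻ x in A, ∫⁻ y in G \ A, ENNReal.ofReal (1 / ‖x - y‖ ^ ((n : ℝ) + δ))

/-- The point `(y, t)` of `ℝⁿ = ℝⁿ⁻¹ × ℝ` (for `n ≥ 1`). -/
def pair {n : ℕ} (y : EuclideanSpace ℝ (Fin (n - 1))) (t : ℝ) : EuclideanSpace ℝ (Fin n) :=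
  WithLp.toLp 2 fun i => if h : (i : ℕ) < n - 1 then y ⟨i, h⟩ else t

/-- `ψ` is a rotation of `ℝⁿ` about the point `x`. -/
def IsRotationAbout {n : ℕ} (x : EuclideanSpace ℝ (Fin n))
    (ψ : EuclideanSpace ℝ (Fin n) → EuclideanSpace ℝ (Fin n)) : Prop :=
  ∃ L : EuclideanSpace ℝ (Fin n) ≃ₗᵢ[ℝ] EuclideanSpace ℝ (Fin n),
    LinearMap.det (L.toLinearEquiv : EuclideanSpace ℝ (Fin n) →ₗ[ℝ] EuclideanSpace ℝ (Fin n)) = 1 ∧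
      ∀ z, ψ z = x + L (z - x)

/-- `Γ` is an `(n-1)`-dimensional `C^∞`-manifold in `G`: a closed set contained in `G` which, near
each of its points and after a rotation about that point, is the graph of a smooth function
`g : U → V` with `U ⊆ ℝⁿ⁻¹` and `V ⊆ ℝ` open. -/
def IsSmoothHypersurface {n : ℕ} (Γ G : Set (EuclideanSpace ℝ (Fin n))) : Prop :=
  IsClosed Γ ∧ Γ ⊆ G ∧ ∀ x ∈ Γ,
    ∃ (ψ : EuclideanSpace ℝ (Fin n) → EuclideanSpace ℝ (Fin n))
      (U : Set (EuclideanSpace ℝ (Fin (n - 1)))) (V : Set ℝ)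
      (g : EuclideanSpace ℝ (Fin (n - 1)) → ℝ),
      IsRotationAbout x ψ ∧ IsOpen U ∧ IsOpen V ∧ ContDiffOn ℝ ∞ g U ∧ Set.MapsTo g U V ∧
      x ∈ ψ '' (Set.image2 pair U V) ∧
      Γ ∩ ψ '' (Set.image2 pair U V) = ψ '' ((fun y => pair y (g y)) '' U)

/-- `D ⊂⊂ G`: the closure of `D` is compact and contained in `G`. -/
def CompactlyContained {n : ℕ} (D G : Set (EuclideanSpace ℝ (Fin n))) : Prop :=
  IsCompact (closure D) ∧ closure D ⊆ G

end FracSobolev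

end

open Filter Topology
open scoped ENNReal

namespace FracSobolev

/-! Condition (A) gives (B) and (C) by testing: functions that are at least `1` on `K` for (B), and
the indicator of `D`, whose seminorm is `2 P_δ(D, G)`, for (C). Conversely, (B) and (C) each imply
the weak-type bound `s |{u ≥ s}|^{1/q} ≤ C |u|` for smooth `u` with compact support in `G`, and this
bound returns (A) with the same constant.

From the weak type to (A): mollifying `1_A` yields `|A|^{1/q} ≤ C |1_A|` for every measurable `A`
inside a compact subset of `G` (`indicator_inequality_of_weak_type`). The coarea formula
`seminorm_eq_lintegral_superlevel` and Minkowski's integral inequality `rpow_lintegral_rpow_le` then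
integrate this over the superlevel sets of `|u|`.

From (B), the weak type follows by scaling (`weak_type_of_capacity_inequality`). From (C), it
follows from the coarea formula once almost every superlevel set has smooth boundary
(`weak_type_of_isoperimetric`). Instead of the full Sard theorem, `u` is perturbed by a small linear
term, cut off away from the support of `u`, so that the relevant critical points are nondegenerate
and the critical values countable; the perturbation then tends to zero. -/

/-! ### Regular level sets are smooth hypersurfaces -/

theorem exists_smooth_implicit_graph {E₁ : Type*} [NormedAddCommGroup E₁] [NormedSpace ℝ E₁]
    [CompleteSpace E₁] {F : E₁ × ℝ → ℝ} (hF : ContDiff ℝ ∞ F) (p : E₁ × ℝ)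
    (hp : fderiv ℝ F p (0, 1) ≠ 0) :
    ∃ (U : Set E₁) (V : Set ℝ) (g : E₁ → ℝ), IsOpen U ∧ IsOpen V ∧ p.1 ∈ U ∧ p.2 ∈ V ∧
      ContDiffOn ℝ ∞ g U ∧ Set.MapsTo g U V ∧ ∀ y ∈ U, ∀ s ∈ V, F (y, s) = F p ↔ g y = s := by
  have inv : ∀ p : E₁ × ℝ, fderiv ℝ F p (0, 1) ≠ 0 →
      (fderiv ℝ F p ∘L .inr ℝ E₁ ℝ).IsInvertible := by
    intro p hp
    refine ⟨ContinuousLinearEquiv.unitsEquivAut ℝ (Units.mk0 _ hp), ?_⟩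
    ext
    simp
  have h0 : (∞ : ℕ∞ω) ≠ 0 := by simp
  have cd : ∀ p, ContDiffAt ℝ ∞ F p := fun p => hF.contDiffAt
  set h := (cd p).implicitFunction h0 (inv p hp) with hh
  have hself : h p.1 = p.2 := (cd p).implicitFunction_apply_self h0 (inv p hp)
  have hsm : ContDiffAt ℝ ∞ h p.1 := (cd p).contDiffAt_implicitFunction h0 (inv p hp)
  have hev := (cd p).eventually_apply_eq_iff_implicitFunction h0 (inv p hp)
  have hne : ∀ᶠ v in 𝓝 p, fderiv ℝ F v (0, 1) ≠ 0 := by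
    have : Continuous fun v => fderiv ℝ F v (0, 1) :=
      (hF.continuous_fderiv (by simp)).clm_apply continuous_const
    exact this.continuousAt.eventually_ne hp
  have hc : ∀ᶠ y in 𝓝 p.1, ContinuousAt h y := by
    have h1 : ContDiffAt ℝ 1 h p.1 := hsm.of_le (by simp)
    exact (h1.eventually (by simp)).mono fun y hy => hy.continuousAt
  obtain ⟨U₀, hU₀, V₀, hV₀, hUV⟩ := mem_nhds_prod_iff.1 (hev.and hne)
  obtain ⟨V, hVV, hVo, hpV⟩ := mem_nhds_iff.1 hV₀
  have hmem : ∀ᶠ y in 𝓝 p.1, h y ∈ V :=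
    hsm.continuousAt.eventually_mem (hVo.mem_nhds (hself ▸ hpV))
  obtain ⟨U, hUU, hUo, hpU⟩ := mem_nhds_iff.1 (inter_mem hU₀ (hc.and hmem))
  have key : ∀ y ∈ U, ∀ s ∈ V, F (y, s) = F p ↔ h y = s := fun y hy s hs =>
    (hUV (Set.mk_mem_prod (hUU hy).1 (hVV hs))).1
  refine ⟨U, V, h, hUo, hVo, hpU, hpV, ?_, fun y hy => (hUU hy).2.2, key⟩
  intro y hy
  apply ContDiffAt.contDiffWithinAt
  have hyV := (hUU hy).2.2
  have hyp : F (y, h y) = F p := (key y hy _ hyV).2 rfl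
  have hn : fderiv ℝ F (y, h y) (0, 1) ≠ 0 :=
    (hUV (Set.mk_mem_prod (hUU hy).1 (hVV hyV))).2
  -- Smoothness of `h` is so far known only at `p.1`. At another `y` the implicit function based at
  -- `(y, h y)` is smooth, and by uniqueness it agrees with `h` near `y`.
  have hev' := (cd (y, h y)).eventually_apply_eq_iff_implicitFunction h0 (inv _ hn)
  have hsm' := (cd (y, h y)).contDiffAt_implicitFunction h0 (inv _ hn)
  refine hsm'.congr_of_eventuallyEq ?_
  have hcy : ContinuousAt (fun y' => (y', h y')) y := continuousAt_id.prodMk (hUU hy).2.1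
  filter_upwards [hcy.eventually hev', hUo.mem_nhds hy] with y' h1 h2
  exact (h1.1 (((key y' h2 _ (hUU h2).2.2).2 rfl).trans hyp.symm)).symm

/-- The reflection in the hyperplane orthogonal to `e - w` sends `e` to `w` but has determinant
`-1`. A preliminary reflection that fixes `e` corrects the sign; its normal `z ⟂ e` exists because
`n ≥ 2`. -/
theorem exists_linearIsometryEquiv_apply_eq_det_eq_one {n : ℕ} (hn : 2 ≤ n)
    (e w : EuclideanSpace ℝ (Fin n)) (hew : ‖e‖ = ‖w‖) :
    ∃ L : EuclideanSpace ℝ (Fin n) ≃ₗᵢ[ℝ] EuclideanSpace ℝ (Fin n),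
      LinearMap.det (L.toLinearEquiv : EuclideanSpace ℝ (Fin n) →ₗ[ℝ] EuclideanSpace ℝ (Fin n)) = 1
        ∧ L e = w := by
  have hdet : ∀ z : EuclideanSpace ℝ (Fin n), z ≠ 0 →
      LinearMap.det ((ℝ ∙ z)ᗮ.reflection.toLinearEquiv :
        EuclideanSpace ℝ (Fin n) →ₗ[ℝ] EuclideanSpace ℝ (Fin n)) = -1 := by
    intro z hz
    have := (ℝ ∙ z)ᗮ.det_reflection (𝕜 := ℝ)
    rw [Submodule.orthogonal_orthogonal, finrank_span_singleton hz, pow_one] at this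
    exact this
  by_cases h : e = w
  · exact ⟨LinearIsometryEquiv.refl ℝ _, by simp, h⟩
  obtain ⟨z, hz, hze⟩ : ∃ z : EuclideanSpace ℝ (Fin n), z ≠ 0 ∧ inner ℝ e z = 0 := by
    have h1 : (ℝ ∙ e)ᗮ ≠ ⊥ := by
      intro h2
      have h3 := Submodule.finrank_add_finrank_orthogonal (𝕜 := ℝ) (ℝ ∙ e)
      rw [h2, finrank_bot, finrank_euclideanSpace_fin] at h3
      have := finrank_span_le_card (R := ℝ) ({e} : Set (EuclideanSpace ℝ (Fin n)))
      simp at this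
      omega
    obtain ⟨z, hz, hz0⟩ := Submodule.exists_mem_ne_zero_of_ne_bot h1
    exact ⟨z, hz0, Submodule.mem_orthogonal_singleton_iff_inner_right.1 hz⟩
  refine ⟨(ℝ ∙ z)ᗮ.reflection.trans (ℝ ∙ (e - w))ᗮ.reflection, ?_, ?_⟩
  · have h1 := hdet z hz
    have h2 := hdet _ (sub_ne_zero.2 h)
    have : ((((ℝ ∙ z)ᗮ.reflection.trans (ℝ ∙ (e - w))ᗮ.reflection)).toLinearEquiv :
        EuclideanSpace ℝ (Fin n) →ₗ[ℝ] EuclideanSpace ℝ (Fin n)) =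
        ((ℝ ∙ (e - w))ᗮ.reflection.toLinearEquiv :
        EuclideanSpace ℝ (Fin n) →ₗ[ℝ] EuclideanSpace ℝ (Fin n)) ∘ₗ
        ((ℝ ∙ z)ᗮ.reflection.toLinearEquiv :
        EuclideanSpace ℝ (Fin n) →ₗ[ℝ] EuclideanSpace ℝ (Fin n)) := rfl
    rw [this, LinearMap.det_comp, h1, h2]
    norm_num
  · have hfix : (ℝ ∙ z)ᗮ.reflection e = e :=
      Submodule.reflection_mem_subspace_eq_self
        (Submodule.mem_orthogonal_singleton_iff_inner_left.2 hze)
    rw [LinearIsometryEquiv.trans_apply, hfix, Submodule.reflection_sub hew]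

/-- The map `(y, t) ↦ pair y t` as a continuous linear map. -/
noncomputable def pairCLM (n : ℕ) :
    EuclideanSpace ℝ (Fin (n - 1)) × ℝ →L[ℝ] EuclideanSpace ℝ (Fin n) :=
  LinearMap.toContinuousLinearMap
    { toFun := fun p => pair p.1 p.2
      map_add' := by
        intro p q
        ext i
        simp only [pair, PiLp.add_apply, Prod.fst_add, Prod.snd_add]
        split_ifs <;> rfl
      map_smul' := by
        intro c p
        ext i
        simp only [pair, PiLp.smul_apply, Prod.smul_fst, Prod.smul_snd, RingHom.id_apply]
        split_ifs <;> rfl }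

theorem pairCLM_apply {n : ℕ} (p : EuclideanSpace ℝ (Fin (n - 1)) × ℝ) :
    pairCLM n p = pair p.1 p.2 := rfl

theorem pair_zero_one_ne_zero {n : ℕ} (hn : 2 ≤ n) :
    (pair 0 1 : EuclideanSpace ℝ (Fin n)) ≠ 0 := by
  intro h
  have := congrArg (fun z : EuclideanSpace ℝ (Fin n) => z ⟨n - 1, by omega⟩) h
  simp [pair] at this

theorem exists_eq_pair {n : ℕ} (hn : 2 ≤ n) (x : EuclideanSpace ℝ (Fin n)) :
    ∃ y s, x = pair y s := by
  refine ⟨WithLp.toLp 2 fun i => x ⟨i, by omega⟩, x ⟨n - 1, by omega⟩, PiLp.ext fun i => ?_⟩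
  simp only [pair]
  split_ifs with h
  · rfl
  · have : i = ⟨n - 1, by omega⟩ := Fin.ext (by have := i.2; simp only; omega)
    rw [← this]

/-- A point of the level set outside the closure of the superlevel set would be a local maximum,
hence critical. -/
theorem frontier_superlevel_eq {E : Type*} [NormedAddCommGroup E] [NormedSpace ℝ E] {v : E → ℝ}
    (hv : Continuous v) {t : ℝ} (hreg : ∀ x, v x = t → fderiv ℝ v x ≠ 0) :
    frontier {x | t < v x} = {x | v x = t} := by
  apply Set.Subset.antisymm
  · intro x hx
    exact (frontier_lt_subset_eq continuous_const hv hx).symm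
  · intro x hx
    rw [(isOpen_lt continuous_const hv).frontier_eq]
    refine ⟨?_, fun h => (ne_of_gt h) hx⟩
    by_contra hcl
    apply hreg x hx
    apply IsLocalMax.fderiv_eq_zero
    have : (closure {x | t < v x})ᶜ ∈ 𝓝 x := isClosed_closure.isOpen_compl.mem_nhds hcl
    filter_upwards [this] with y hy
    rw [hx]
    exact not_lt.1 fun h => hy (subset_closure h)

theorem isSmoothHypersurface_frontier_superlevel {n : ℕ} (hn : 2 ≤ n)
    {G : Set (EuclideanSpace ℝ (Fin n))} {v : EuclideanSpace ℝ (Fin n) → ℝ} (hv : ContDiff ℝ ∞ v)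
    {t : ℝ} (hreg : ∀ x, v x = t → fderiv ℝ v x ≠ 0) (hG : frontier {x | t < v x} ⊆ G) :
    IsSmoothHypersurface (frontier {x | t < v x}) G := by
  refine ⟨isClosed_frontier, hG, ?_⟩
  rw [frontier_superlevel_eq hv.continuous hreg]
  intro x hx
  obtain ⟨w, hw⟩ : ∃ w, fderiv ℝ v x w ≠ 0 := by
    by_contra! h
    exact hreg x hx (ContinuousLinearMap.ext h)
  have hw0 : w ≠ 0 := by rintro rfl; simp at hw
  -- Rotate the last coordinate axis onto a direction in which the derivative of `v` does not
  -- vanish, so that the implicit function theorem solves for the last coordinate.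
  obtain ⟨L, hL1, hL⟩ := exists_linearIsometryEquiv_apply_eq_det_eq_one hn
    (pair 0 1 : EuclideanSpace ℝ (Fin n)) ((‖(pair 0 1 : EuclideanSpace ℝ (Fin n))‖ / ‖w‖) • w) (by
      rw [norm_smul, norm_div, norm_norm, norm_norm, div_mul_cancel₀ _ (norm_ne_zero_iff.2 hw0)])
  obtain ⟨y₀, s₀, hx₀⟩ := exists_eq_pair hn x
  let ψ : EuclideanSpace ℝ (Fin n) → EuclideanSpace ℝ (Fin n) := fun z => x + L (z - x)
  have hψx : ψ x = x := by simp [ψ]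
  let F : EuclideanSpace ℝ (Fin (n - 1)) × ℝ → ℝ := fun p => v (x + L (pairCLM n p - x))
  have hF : ContDiff ℝ ∞ F := by
    apply hv.comp
    exact contDiff_const.add (L.contDiff.comp ((pairCLM n).contDiff.sub contDiff_const))
  have hd : fderiv ℝ F (y₀, s₀) (0, 1) ≠ 0 := by
    have hin : HasFDerivAt (fun p => x + L (pairCLM n p - x))
        ((L.toContinuousLinearEquiv : _ →L[ℝ] _) ∘L pairCLM n) (y₀, s₀) :=
      (L.toContinuousLinearEquiv.hasFDerivAt.comp (y₀, s₀)
        ((pairCLM n).hasFDerivAt.sub_const x)).const_add x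
    have hbase : x + L (pairCLM n (y₀, s₀) - x) = x := by
      rw [pairCLM_apply, ← hx₀]; simp
    have hvd : HasFDerivAt v (fderiv ℝ v x) (x + L (pairCLM n (y₀, s₀) - x)) := by
      rw [hbase]
      exact (hv.differentiable (by simp) x).hasFDerivAt
    have hFd : HasFDerivAt F _ (y₀, s₀) := hvd.comp (y₀, s₀) hin
    rw [hFd.fderiv]
    have : (fderiv ℝ v x ∘L ((L.toContinuousLinearEquiv : _ →L[ℝ] _) ∘L pairCLM n)) (0, 1)
        = fderiv ℝ v x (L (pair 0 1)) := rfl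
    rw [this, hL, map_smul, smul_eq_mul]
    exact mul_ne_zero (div_ne_zero (norm_ne_zero_iff.2 (pair_zero_one_ne_zero hn))
      (norm_ne_zero_iff.2 hw0)) hw
  obtain ⟨U, V, g, hU, hV, hy₀, hs₀, hg, hgm, hiff⟩ := exists_smooth_implicit_graph hF _ hd
  have hFp : F (y₀, s₀) = t := by
    change v (x + L (pairCLM n (y₀, s₀) - x)) = t
    rw [pairCLM_apply, ← hx₀]
    simpa using hx
  refine ⟨ψ, U, V, g, ⟨L, hL1, fun z => rfl⟩, hU, hV, hg, hgm,
    ⟨x, ⟨y₀, hy₀, s₀, hs₀, hx₀.symm⟩, hψx⟩, ?_⟩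
  apply Set.Subset.antisymm
  · rintro _ ⟨hz, _, ⟨y, hy, s, hs, rfl⟩, rfl⟩
    have : F (y, s) = F (y₀, s₀) := by rw [hFp]; exact hz
    exact ⟨_, ⟨y, hy, rfl⟩, by simp only [(hiff y hy s hs).1 this]⟩
  · rintro _ ⟨_, ⟨y, hy, rfl⟩, rfl⟩
    refine ⟨?_, _, ⟨y, hy, g y, hgm hy, rfl⟩, rfl⟩
    have : F (y, g y) = F (y₀, s₀) := (hiff y hy _ (hgm hy)).2 rfl
    rw [hFp] at this
    exact this

/-! ### The seminorm, its value on indicators, and the coarea formula -/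

/-- The kernel `|z|^{-(n+δ)}` with values in `[0, ∞]` (and value `0` at `z = 0`). -/
noncomputable def kernel {n : ℕ} (δ : ℝ) (z : EuclideanSpace ℝ (Fin n)) : ℝ≥0∞ :=
  ENNReal.ofReal (1 / ‖z‖ ^ ((n : ℝ) + δ))

variable {n : ℕ} {δ : ℝ} {G : Set (EuclideanSpace ℝ (Fin n))}

@[fun_prop]
theorem measurable_kernel : Measurable (kernel δ : EuclideanSpace ℝ (Fin n) → ℝ≥0∞) := by
  unfold kernel
  fun_prop

theorem kernel_sub_comm (x y : EuclideanSpace ℝ (Fin n)) :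
    kernel δ (x - y) = kernel δ (y - x) := by
  rw [kernel, kernel, norm_sub_rev]

theorem seminorm_eq (u : EuclideanSpace ℝ (Fin n) → ℝ) :
    seminorm δ G u = ∫⁻ x in G, ∫⁻ y in G, ‖u x - u y‖ₑ * kernel δ (x - y) := by
  unfold seminorm kernel
  congr! 6 with x y
  rw [Real.enorm_eq_ofReal_abs, ← ENNReal.ofReal_mul (abs_nonneg _), mul_one_div]

theorem seminorm_mono {u w : EuclideanSpace ℝ (Fin n) → ℝ}
    (h : ∀ x y, |u x - u y| ≤ |w x - w y|) : seminorm δ G u ≤ seminorm δ G w := by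
  rw [seminorm_eq, seminorm_eq]
  gcongr with x y
  rw [Real.enorm_eq_ofReal_abs, Real.enorm_eq_ofReal_abs]
  exact ENNReal.ofReal_le_ofReal (h x y)

theorem measurable_enorm_sub_mul_kernel {F : Type*} [NormedAddCommGroup F] [MeasurableSpace F]
    [BorelSpace F] [SecondCountableTopology F]
    {u : EuclideanSpace ℝ (Fin n) → F} (hu : Measurable u) :
    Measurable fun p : EuclideanSpace ℝ (Fin n) × EuclideanSpace ℝ (Fin n) =>
      ‖u p.1 - u p.2‖ₑ * kernel δ (p.1 - p.2) := by
  fun_prop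

theorem seminorm_add_le {u w : EuclideanSpace ℝ (Fin n) → ℝ} (hu : Measurable u) :
    seminorm δ G (fun x => u x + w x) ≤ seminorm δ G u + seminorm δ G w := by
  have hm := measurable_enorm_sub_mul_kernel (δ := δ) hu
  rw [seminorm_eq, seminorm_eq, seminorm_eq,
    ← lintegral_add_left (Measurable.lintegral_prod_right' hm)]
  refine lintegral_mono fun x => ?_
  simp only
  rw [← lintegral_add_left (f := fun y => ‖u x - u y‖ₑ * kernel δ (x - y)) (by fun_prop)]
  refine lintegral_mono fun y => ?_
  simp only
  rw [← add_mul, add_sub_add_comm]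
  gcongr
  exact enorm_add_le _ _

theorem seminorm_const_mul {u : EuclideanSpace ℝ (Fin n) → ℝ} (hu : Measurable u) (c : ℝ) :
    seminorm δ G (fun x => c * u x) = ‖c‖ₑ * seminorm δ G u := by
  have hm := measurable_enorm_sub_mul_kernel (δ := δ) hu
  rw [seminorm_eq, seminorm_eq, ← lintegral_const_mul _ (Measurable.lintegral_prod_right' hm)]
  refine lintegral_congr fun x => ?_
  simp only
  rw [← lintegral_const_mul _ (f := fun y => ‖u x - u y‖ₑ * kernel δ (x - y)) (by fun_prop)]
  refine lintegral_congr fun y => ?_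
  rw [← mul_sub, enorm_mul, mul_assoc]

theorem seminorm_congr_ae {u w : EuclideanSpace ℝ (Fin n) → ℝ} (h : u =ᵐ[volume] w) :
    seminorm δ G u = seminorm δ G w := by
  rw [seminorm_eq, seminorm_eq]
  have h' := ae_restrict_of_ae (s := G) h
  refine lintegral_congr_ae ?_
  filter_upwards [h'] with x hx
  refine lintegral_congr_ae ?_
  filter_upwards [h'] with y hy
  rw [hx, hy]

/-- Only the pairs with exactly one point in `A` contribute, and the kernel is symmetric. This is
the source of the factor `2` in (C). -/
theorem seminorm_indicator_eq {A : Set (EuclideanSpace ℝ (Fin n))} (hA : MeasurableSet A)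
    (hG : MeasurableSet G) (hAG : A ⊆ G) :
    seminorm δ G (A.indicator 1) = 2 * perimeter δ A G := by
  have hm : Measurable fun p : EuclideanSpace ℝ (Fin n) × EuclideanSpace ℝ (Fin n) =>
      kernel δ (p.1 - p.2) := by fun_prop
  have hsplit : ∀ f : EuclideanSpace ℝ (Fin n) → ℝ≥0∞,
      ∫⁻ x in G, f x = (∫⁻ x in A, f x) + ∫⁻ x in G \ A, f x := by
    intro f
    rw [← lintegral_inter_add_sdiff f G hA, Set.inter_eq_self_of_subset_right hAG]
  have h1 : ∫⁻ x in A, ∫⁻ y in G,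
      ‖A.indicator (1 : EuclideanSpace ℝ (Fin n) → ℝ) x - A.indicator 1 y‖ₑ * kernel δ (x - y)
      = perimeter δ A G := by
    refine setLIntegral_congr_fun hA fun x hx => ?_
    rw [hsplit, setLIntegral_congr_fun (g := 0) hA, setLIntegral_congr_fun (hG.diff hA)
      (g := fun y => kernel δ (x - y))]
    · simp [kernel]
    · intro y hy
      simp [hx, hy.2]
    · intro y hy
      simp [hx, hy]
  have h2 : ∫⁻ x in G \ A, ∫⁻ y in G,
      ‖A.indicator (1 : EuclideanSpace ℝ (Fin n) → ℝ) x - A.indicator 1 y‖ₑ * kernel δ (x - y)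
        = perimeter δ A G := by
    have : perimeter δ A G = ∫⁻ x in G \ A, ∫⁻ y in A, kernel δ (x - y) := by
      unfold perimeter
      rw [lintegral_lintegral_swap (f := fun x y => kernel δ (x - y)) hm.aemeasurable]
      simp only [kernel_sub_comm]
      rfl
    rw [this]
    refine setLIntegral_congr_fun (hG.diff hA) fun x hx => ?_
    rw [hsplit, setLIntegral_congr_fun hA (g := fun y => kernel δ (x - y)),
      setLIntegral_congr_fun (g := 0) (hG.diff hA)]
    · simp
    · intro y hy
      simp [hx.2, hy.2]
    · intro y hy
      simp [hx.2, hy]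
  rw [seminorm_eq, hsplit, h1, h2, two_mul]

theorem enorm_sub_eq_lintegral (a b : ℝ) :
    ‖a - b‖ₑ = ∫⁻ t : ℝ, ‖(if t < a then 1 else 0 : ℝ) - (if t < b then 1 else 0)‖ₑ := by
  wlog h : b ≤ a generalizing a b
  · rw [enorm_sub_rev, this b a (le_of_not_ge h)]
    simp only [enorm_sub_rev]
  have : ∀ t : ℝ, ‖(if t < a then 1 else 0 : ℝ) - (if t < b then 1 else 0)‖ₑ
      = (Set.Ico b a).indicator 1 t := by
    intro t
    by_cases h1 : t < b
    · simp [h1, h1.trans_le h]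
    · by_cases h2 : t < a
      · simp [h1, h2, not_lt.1 h1]
      · simp [h1, h2]
  simp only [this]
  rw [lintegral_indicator_one measurableSet_Ico, Real.volume_Ico, Real.enorm_eq_ofReal_abs,
    abs_of_nonneg (sub_nonneg.2 h)]

/-- Coarea formula: `|a - b|` is the measure of the levels `t` separating `a` from `b`; Tonelli does
the rest. -/
theorem seminorm_eq_lintegral_superlevel {u : EuclideanSpace ℝ (Fin n) → ℝ} (hu : Measurable u) :
    seminorm δ G u = ∫⁻ t : ℝ, seminorm δ G ({x | t < u x}.indicator 1) := by
  have hm1 : Measurable fun p : (EuclideanSpace ℝ (Fin n) × ℝ) × EuclideanSpace ℝ (Fin n) =>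
      ‖(if p.1.2 < u p.1.1 then 1 else 0 : ℝ) - (if p.1.2 < u p.2 then 1 else 0)‖ₑ *
        kernel δ (p.1.1 - p.2) := by
    have h1 : Measurable fun p : (EuclideanSpace ℝ (Fin n) × ℝ) × EuclideanSpace ℝ (Fin n) =>
        (if p.1.2 < u p.1.1 then 1 else 0 : ℝ) :=
      Measurable.ite (measurableSet_lt (by fun_prop) (by fun_prop)) measurable_const
        measurable_const
    have h2 : Measurable fun p : (EuclideanSpace ℝ (Fin n) × ℝ) × EuclideanSpace ℝ (Fin n) =>
        (if p.1.2 < u p.2 then 1 else 0 : ℝ) :=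
      Measurable.ite (measurableSet_lt (by fun_prop) (by fun_prop)) measurable_const
        measurable_const
    fun_prop
  have hm2 : Measurable fun p : EuclideanSpace ℝ (Fin n) × ℝ => ∫⁻ y in G,
      ‖(if p.2 < u p.1 then 1 else 0 : ℝ) - (if p.2 < u y then 1 else 0)‖ₑ *
        kernel δ (p.1 - y) := Measurable.lintegral_prod_right' hm1
  simp only [seminorm_eq, Set.indicator, Set.mem_ofPred_eq, Pi.one_apply]
  rw [lintegral_lintegral_swap (μ := volume)
    (f := fun (t : ℝ) x => ∫⁻ y in G, ‖(if t < u x then 1 else 0 : ℝ) - (if t < u y then 1 else 0)‖ₑ *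
        kernel δ (x - y)) (hm2.comp measurable_swap).aemeasurable]
  refine lintegral_congr fun x => ?_
  have hm3 : Measurable fun p : ℝ × EuclideanSpace ℝ (Fin n) =>
      ‖(if p.1 < u x then 1 else 0 : ℝ) - (if p.1 < u p.2 then 1 else 0)‖ₑ *
        kernel δ (x - p.2) :=
    hm1.comp (g := fun p => _)
      (by fun_prop : Measurable fun p : ℝ × EuclideanSpace ℝ (Fin n) => ((x, p.1), p.2))
  rw [lintegral_lintegral_swap (μ := volume)
    (f := fun (t : ℝ) y => ‖(if t < u x then 1 else 0 : ℝ) - (if t < u y then 1 else 0)‖ₑ *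
        kernel δ (x - y)) hm3.aemeasurable]
  refine lintegral_congr fun y => ?_
  rw [lintegral_mul_const', enorm_sub_eq_lintegral]
  exact ENNReal.ofReal_ne_top

/-! ### Integrability of the kernel and finite energy of Lipschitz functions -/

theorem lintegral_kernel_compl_ball_lt_top (hn : 2 ≤ n) (hδ : 0 < δ) {d : ℝ} (hd : 0 < d) :
    ∫⁻ z in (Metric.ball (0 : EuclideanSpace ℝ (Fin n)) d)ᶜ, kernel δ z < ⊤ := by
  have : NeZero n := ⟨by omega⟩
  have hint : Integrable (fun z : EuclideanSpace ℝ (Fin n) =>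
      (Set.Ici d).indicator (fun r : ℝ => 1 / r ^ ((n : ℝ) + δ)) ‖z‖) := by
    rw [integrable_fun_norm_addHaar volume
      (f := (Set.Ici d).indicator (fun r : ℝ => 1 / r ^ ((n : ℝ) + δ)))]
    -- In polar coordinates `r^(n-1) * r^(-(n+δ)) = r^(-1-δ)`, integrable at infinity since `δ > 0`.
    have h1 : IntegrableOn (fun r : ℝ => r ^ (-1 - δ)) (Set.Ici d) := by
      rw [integrableOn_Ici_iff_integrableOn_Ioi]
      exact integrableOn_Ioi_rpow_of_lt (by linarith) hd
    have h2 := (h1.integrable_indicator measurableSet_Ici).integrableOn (s := Set.Ioi 0)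
    refine h2.congr_fun ?_ measurableSet_Ioi
    intro y hy
    have hy : 0 < y := hy
    simp only [Set.indicator, finrank_euclideanSpace_fin, smul_eq_mul]
    split_ifs
    · rw [← Real.rpow_natCast, one_div, ← Real.rpow_neg hy.le, ← Real.rpow_add hy,
        Nat.cast_sub (by omega)]
      congr 1
      push_cast
      ring
    · simp
  have hlt := hint.lintegral_lt_top
  refine lt_of_le_of_lt ?_ hlt
  rw [← lintegral_indicator Metric.isOpen_ball.measurableSet.compl]
  refine lintegral_mono fun z => ?_
  by_cases hz : d ≤ ‖z‖
  · simp [Set.indicator, hz, kernel]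
  · simp [Set.indicator, hz]

theorem lintegral_norm_mul_kernel_ball_lt_top (hn : 2 ≤ n) (hδ1 : δ < 1) :
    ∫⁻ z in Metric.ball (0 : EuclideanSpace ℝ (Fin n)) 1, ‖z‖ₑ * kernel δ z < ⊤ := by
  have : NeZero n := ⟨by omega⟩
  have hint : IntegrableOn (fun z : EuclideanSpace ℝ (Fin n) =>
      (fun r : ℝ => r * (1 / r ^ ((n : ℝ) + δ))) ‖z‖) (Metric.ball 0 1) := by
    rw [integrableOn_fun_norm_addHaar volume (f := (fun r : ℝ => r * (1 / r ^ ((n : ℝ) + δ))))]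
    -- The extra factor `r` leaves `r^(-δ)`, integrable at `0` since `δ < 1`.
    have h1 : IntegrableOn (fun r : ℝ => r ^ (-δ)) (Set.Ioo 0 1) := by
      rw [intervalIntegral.integrableOn_Ioo_rpow_iff one_pos]
      linarith
    refine h1.congr_fun ?_ measurableSet_Ioo
    intro y hy
    have hy : 0 < y := hy.1
    simp only [finrank_euclideanSpace_fin, smul_eq_mul]
    rw [← Real.rpow_natCast, one_div, ← Real.rpow_neg hy.le, ← mul_assoc,
      ← Real.rpow_add_one hy.ne', ← Real.rpow_add hy, Nat.cast_sub (by omega)]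
    congr 1
    push_cast
    ring
  refine lt_of_le_of_lt (le_of_eq ?_) hint.lintegral_lt_top
  refine lintegral_congr fun z => ?_
  rw [ENNReal.ofReal_mul (norm_nonneg _), ofReal_norm, kernel]

theorem lintegral_lintegral_enorm_sub_mul_kernel_lt_top (hn : 2 ≤ n) (hδ0 : 0 < δ) (hδ1 : δ < 1)
    {F : Type*} [NormedAddCommGroup F] {H : EuclideanSpace ℝ (Fin n) → F} {L : NNReal}
    (hL : LipschitzWith L H) (hc : HasCompactSupport H) :
    ∫⁻ x, ∫⁻ y, ‖H x - H y‖ₑ * kernel δ (x - y) < ⊤ := by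
  obtain ⟨M, hM⟩ : ∃ M : ℝ≥0∞, M ≠ ⊤ ∧ ∀ x, ‖H x‖ₑ ≤ M := by
    obtain ⟨M, hM⟩ := hc.exists_bound_of_continuous hL.continuous
    refine ⟨ENNReal.ofReal M, ENNReal.ofReal_ne_top, fun x => ?_⟩
    rw [← ofReal_norm]
    exact ENNReal.ofReal_le_ofReal (hM x)
  set B := Metric.ball (0 : EuclideanSpace ℝ (Fin n)) 1
  -- An integrable majorant in `x - y`: the Lipschitz bound near the diagonal, the sup bound away
  -- from it. Since `x` or `y` must lie in the support, the energy is at most `2 |S| ∫ m`.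
  let m : EuclideanSpace ℝ (Fin n) → ℝ≥0∞ := fun z =>
    B.indicator (fun z => L * (‖z‖ₑ * kernel δ z)) z + Bᶜ.indicator (fun z => 2 * M * kernel δ z) z
  have hB : MeasurableSet B := Metric.isOpen_ball.measurableSet
  have hm : Measurable m := by
    refine Measurable.add (Measurable.indicator (by fun_prop) hB)
      (Measurable.indicator (by fun_prop) hB.compl)
  have hmint : ∫⁻ z, m z < ⊤ := by
    rw [lintegral_add_left (Measurable.indicator (by fun_prop) hB), lintegral_indicator hB,
      lintegral_indicator hB.compl, lintegral_const_mul _ (by fun_prop),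
      lintegral_const_mul _ (by fun_prop)]
    exact ENNReal.add_lt_top.2
      ⟨ENNReal.mul_lt_top (by simp) (lintegral_norm_mul_kernel_ball_lt_top hn hδ1),
        ENNReal.mul_lt_top (ENNReal.mul_lt_top (by simp) hM.1.lt_top)
          (lintegral_kernel_compl_ball_lt_top hn hδ0 one_pos)⟩
  set S := tsupport H
  have hS : MeasurableSet S := (isClosed_tsupport H).measurableSet
  have hle : ∀ x y, ‖H x - H y‖ₑ * kernel δ (x - y) ≤
      S.indicator (fun _ => m (x - y)) x + S.indicator (fun y => m (x - y)) y := by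
    intro x y
    have key : ‖H x - H y‖ₑ * kernel δ (x - y) ≤ m (x - y) := by
      by_cases hxy : x - y ∈ B
      · simp only [m, Set.indicator_of_mem hxy, Set.indicator_of_notMem (Set.notMem_compl_iff.2 hxy),
          add_zero, ← mul_assoc]
        gcongr
        have := hL.edist_le_mul x y
        rwa [edist_eq_enorm_sub, edist_eq_enorm_sub] at this
      · simp only [m, Set.indicator_of_notMem hxy, Set.indicator_of_mem (Set.mem_compl hxy), zero_add]
        gcongr
        calc ‖H x - H y‖ₑ ≤ ‖H x‖ₑ + ‖H y‖ₑ := enorm_sub_le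
          _ ≤ M + M := add_le_add (hM.2 x) (hM.2 y)
          _ = 2 * M := (two_mul M).symm
    by_cases hx : x ∈ S
    · rw [Set.indicator_of_mem hx]
      exact key.trans le_self_add
    · by_cases hy : y ∈ S
      · rw [Set.indicator_of_mem hy]
        exact key.trans le_add_self
      · rw [image_eq_zero_of_notMem_tsupport hx, image_eq_zero_of_notMem_tsupport hy]
        simp
  have hI : ∀ x, ∫⁻ y, m (x - y) = ∫⁻ z, m z := fun x => lintegral_sub_left_eq_self m x
  have hI' : ∀ y, ∫⁻ x, m (x - y) = ∫⁻ z, m z := fun y => lintegral_sub_right_eq_self m y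
  have hSc : volume S < ⊤ := hc.isCompact.measure_lt_top
  have hm1 : Measurable fun p : EuclideanSpace ℝ (Fin n) × EuclideanSpace ℝ (Fin n) =>
      S.indicator (fun _ => m (p.1 - p.2)) p.1 := by
    have : (fun p : EuclideanSpace ℝ (Fin n) × EuclideanSpace ℝ (Fin n) =>
      S.indicator (fun _ => m (p.1 - p.2)) p.1) = (Prod.fst ⁻¹' S).indicator
        fun p => m (p.1 - p.2) := rfl
    rw [this]
    exact Measurable.indicator (by fun_prop) (measurable_fst hS)
  have hm2 : Measurable fun p : EuclideanSpace ℝ (Fin n) × EuclideanSpace ℝ (Fin n) =>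
      S.indicator (fun y => m (p.1 - y)) p.2 := by
    have : (fun p : EuclideanSpace ℝ (Fin n) × EuclideanSpace ℝ (Fin n) =>
      S.indicator (fun y => m (p.1 - y)) p.2) = (Prod.snd ⁻¹' S).indicator
        fun p => m (p.1 - p.2) := rfl
    rw [this]
    exact Measurable.indicator (by fun_prop) (measurable_snd hS)
  have e1 : ∫⁻ x, ∫⁻ y, S.indicator (fun _ => m (x - y)) x = (∫⁻ z, m z) * volume S := by
    rw [← setLIntegral_const, ← lintegral_indicator hS]
    refine lintegral_congr fun x => ?_
    by_cases hx : x ∈ S <;> simp [hx, hI]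
  have e2 : ∫⁻ x, ∫⁻ y, S.indicator (fun y => m (x - y)) y = (∫⁻ z, m z) * volume S := by
    rw [lintegral_lintegral_swap (f := fun x y => S.indicator (fun y => m (x - y)) y)
      hm2.aemeasurable, ← setLIntegral_const, ← lintegral_indicator hS]
    refine lintegral_congr fun y => ?_
    by_cases hy : y ∈ S <;> simp [hy, hI']
  calc ∫⁻ x, ∫⁻ y, ‖H x - H y‖ₑ * kernel δ (x - y)
      ≤ ∫⁻ x, ∫⁻ y, (S.indicator (fun _ => m (x - y)) x + S.indicator (fun y => m (x - y)) y) := by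
        gcongr with x y
        exact hle x y
    _ = ∫⁻ x, ((∫⁻ y, S.indicator (fun _ => m (x - y)) x)
          + ∫⁻ y, S.indicator (fun y => m (x - y)) y) := by
        refine lintegral_congr fun x => ?_
        exact lintegral_add_left (hm1.comp measurable_prodMk_left) _
    _ = (∫⁻ z, m z) * volume S + (∫⁻ z, m z) * volume S := by
        rw [lintegral_add_left (Measurable.lintegral_prod_right' hm1), e1, e2]
    _ < ⊤ := ENNReal.add_lt_top.2 ⟨ENNReal.mul_lt_top hmint hSc, ENNReal.mul_lt_top hmint hSc⟩

/-! ### Linear perturbations with countably many critical values -/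

theorem countable_of_forall_eventually_ne {X : Type*} [TopologicalSpace X]
    [SecondCountableTopology X] {s : Set X} (h : ∀ x ∈ s, ∀ᶠ y in 𝓝[≠] x, y ∉ s) :
    s.Countable := by
  have : DiscreteTopology s := by
    rw [discreteTopology_subtype_iff]
    intro x hx
    exact disjoint_iff.1 (Filter.disjoint_principal_right.2 (h x hx))
  exact Set.countable_coe_iff.1 countable_of_Lindelof_of_discrete

/-- For almost every linear perturbation of a smooth function all critical points are
nondegenerate, hence isolated. -/
theorem exists_norm_lt_countable_critical_values {E : Type*} [NormedAddCommGroup E]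
    [InnerProductSpace ℝ E] [FiniteDimensional ℝ E] {u : E → ℝ} (hu : ContDiff ℝ ∞ u) {r : ℝ}
    (hr : 0 < r) :
    ∃ a : E, ‖a‖ < r ∧
      ((fun x => u x + inner ℝ a x) '' {x | fderiv ℝ u x + innerSL ℝ a = 0}).Countable := by
  let _ : MeasurableSpace E := borel E
  have : BorelSpace E := ⟨rfl⟩
  -- With `g = -∇u`, the critical points of `u + ⟨a, ·⟩` are the solutions of `g x = a`. The image
  -- under `g` of the points with singular derivative is null, so some small `a` avoids it; the
  -- inverse function theorem then isolates each solution.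
  let g : E → E := fun x => -(InnerProductSpace.toDual ℝ E).symm (fderiv ℝ u x)
  have hg : ContDiff ℝ ∞ g :=
    ((InnerProductSpace.toDual ℝ E).symm.contDiff.comp (hu.fderiv_right (by simp))).neg
  have hgd : ∀ x, HasStrictFDerivAt g (fderiv ℝ g x) x := fun x =>
    hg.contDiffAt.hasStrictFDerivAt (by simp)
  have hnull := addHaar_image_eq_zero_of_det_fderivWithin_eq_zero (μ := Measure.addHaar)
    (s := {x | (fderiv ℝ g x).det = 0}) (f := g) (f' := fderiv ℝ g)
    (fun x _ => (hgd x).hasFDerivAt.hasFDerivWithinAt) (fun x hx => hx)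
  obtain ⟨a, har, ha⟩ : ∃ a ∈ Metric.ball (0 : E) r, a ∉ g '' {x | (fderiv ℝ g x).det = 0} := by
    by_contra! h
    exact (Metric.measure_ball_pos Measure.addHaar (0 : E) hr).ne' (measure_mono_null h hnull)
  refine ⟨a, by simpa using har, Set.Countable.image ?_ _⟩
  have hga : ∀ x, fderiv ℝ u x + innerSL ℝ a = 0 ↔ g x = a := by
    intro x
    have : innerSL ℝ a = InnerProductSpace.toDual ℝ E a := rfl
    rw [this, ← (InnerProductSpace.toDual ℝ E).symm.map_eq_zero_iff, map_add,
      LinearIsometryEquiv.symm_apply_apply, add_eq_zero_iff_neg_eq]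
  simp only [hga]
  refine countable_of_forall_eventually_ne fun x hx => ?_
  have hdet : (fderiv ℝ g x).det ≠ 0 := fun h => ha ⟨x, h, hx⟩
  have h1 : HasFDerivAt g
      ((fderiv ℝ g x).toContinuousLinearEquivOfDetNeZero hdet : E →L[ℝ] E) x := (hgd x).hasFDerivAt
  exact h1.eventually_ne ⟨_, ContinuousLinearEquiv.antilipschitz _⟩

open scoped Manifold in
theorem exists_contDiff_cutoff {E : Type*} [NormedAddCommGroup E] [NormedSpace ℝ E]
    [FiniteDimensional ℝ E] {K G : Set E} (hK : IsCompact K) (hG : IsOpen G) (hKG : K ⊆ G) :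
    ∃ χ : E → ℝ, ContDiff ℝ ∞ χ ∧ (∀ᶠ x in 𝓝ˢ K, χ x = 1) ∧ HasCompactSupport χ := by
  obtain ⟨K', hK', hKK', -⟩ := exists_compact_between hK hG hKG
  obtain ⟨χ, h1, h0, -⟩ := exists_contMDiffMap_one_nhds_of_subset_interior (n := ⊤) 𝓘(ℝ, E)
    hK.isClosed hKK'
  exact ⟨χ, χ.contMDiff.contDiff, h1, HasCompactSupport.intro hK' h0⟩

/-! ### From the isoperimetric inequality to the weak-type bound -/

theorem weak_type_of_isoperimetric (hn : 2 ≤ n) (hδ0 : 0 < δ) (hδ1 : δ < 1) (hG : IsOpen G)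
    {p C : ℝ} (hp : 0 ≤ p)
    (H : ∀ D : Set (EuclideanSpace ℝ (Fin n)), IsOpen D → CompactlyContained D G →
      IsSmoothHypersurface (frontier D) G →
        volume D ^ p ≤ ENNReal.ofReal (2 * C) * perimeter δ D G)
    {u : EuclideanSpace ℝ (Fin n) → ℝ} (hu : ContDiff ℝ ∞ u) (huG : CompactSupportIn G u)
    {s : ℝ} (hs : 0 < s) :
    ENNReal.ofReal s * volume {x | s ≤ u x} ^ p ≤ ENNReal.ofReal C * seminorm δ G u := by
  obtain ⟨χ, hχ, hχ1, hχc⟩ := exists_contDiff_cutoff huG.1.isCompact hG huG.2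
  -- A cut-off identity: `⟨a, f x⟩` is linear near the support of `u`, yet bounded and of finite
  -- energy.
  let f : EuclideanSpace ℝ (Fin n) → EuclideanSpace ℝ (Fin n) := fun x => χ x • x
  have hf : ContDiff ℝ ∞ f := hχ.smul contDiff_id
  have hfc : HasCompactSupport f := hχc.smul_right
  obtain ⟨L, hL⟩ := hf.lipschitzWith_of_hasCompactSupport hfc (by simp)
  obtain ⟨M, hM⟩ := hfc.exists_bound_of_continuous hf.continuous
  have hM0 : 0 ≤ M := (norm_nonneg _).trans (hM 0)
  set S := ∫⁻ x, ∫⁻ y, ‖f x - f y‖ₑ * kernel δ (x - y) with hS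
  have hSt : S < ⊤ := lintegral_lintegral_enorm_sub_mul_kernel_lt_top hn hδ0 hδ1 hL hfc
  have h2C : ENNReal.ofReal (2 * C) = 2 * ENNReal.ofReal C := by
    rw [ENNReal.ofReal_mul zero_le_two, ENNReal.ofReal_ofNat]
  have claim : ∀ η : ℝ, 0 < η → ENNReal.ofReal (s - 2 * η) * volume {x | s ≤ u x} ^ p ≤
      ENNReal.ofReal C * (seminorm δ G u + ENNReal.ofReal η * S) := by
    intro η hη
    -- The bound `η` on `‖a‖` controls the energy of the perturbation, and `η / (M + 1)` its
    -- supremum.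
    obtain ⟨a, ha, hcount⟩ := exists_norm_lt_countable_critical_values hu
      (lt_min hη (div_pos hη (by linarith : 0 < M + 1)))
    have hfa : ∀ x, |inner ℝ a (f x)| ≤ η := by
      intro x
      calc |inner ℝ a (f x)| ≤ ‖a‖ * ‖f x‖ := abs_real_inner_le_norm _ _
        _ ≤ (η / (M + 1)) * (M + 1) := by
          gcongr
          · exact (ha.trans_le (min_le_right _ _)).le
          · linarith [hM x]
        _ = η := div_mul_cancel₀ _ (by linarith)
    let v : EuclideanSpace ℝ (Fin n) → ℝ := fun x => u x + inner ℝ a (f x)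
    have hv : ContDiff ℝ ∞ v := hu.add (contDiff_const.inner ℝ hf)
    have hvu : seminorm δ G v ≤ seminorm δ G u + ENNReal.ofReal η * S := by
      refine (seminorm_add_le hu.continuous.measurable).trans ?_
      gcongr
      rw [seminorm_eq]
      calc ∫⁻ x in G, ∫⁻ y in G, ‖inner ℝ a (f x) - inner ℝ a (f y)‖ₑ * kernel δ (x - y)
          ≤ ∫⁻ x, ∫⁻ y, ‖inner ℝ a (f x) - inner ℝ a (f y)‖ₑ * kernel δ (x - y) :=
            (lintegral_mono fun x => setLIntegral_le_lintegral _ _).trans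
              (setLIntegral_le_lintegral _ _)
        _ ≤ ∫⁻ x, ∫⁻ y, ENNReal.ofReal η * (‖f x - f y‖ₑ * kernel δ (x - y)) := by
            refine lintegral_mono fun x => lintegral_mono fun y => ?_
            rw [← mul_assoc]
            refine mul_le_mul_left ?_ _
            rw [← inner_sub_right, ← ofReal_norm, ← ofReal_norm,
              ← ENNReal.ofReal_mul hη.le]
            gcongr
            exact (norm_inner_le_norm _ _).trans
              (by gcongr; exact (ha.trans_le (min_le_left _ _)).le)
        _ = ENNReal.ofReal η * S := by
            simp only [lintegral_const_mul' _ _ ENNReal.ofReal_ne_top, hS]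
    have hsupp : ∀ t, η < t → ∀ x, t ≤ v x → x ∈ tsupport u := by
      intro t ht x hx
      by_contra hxs
      have h1 := hfa x
      have h2 := le_abs_self (inner ℝ a (f x))
      simp only [v, image_eq_zero_of_notMem_tsupport hxs] at hx
      linarith
    have hlevel : ∀ t, η < t → t ∉ ((fun x => u x + inner ℝ a x) ''
        {x | fderiv ℝ u x + innerSL ℝ a = 0}) →
        volume {x | t < v x} ^ p ≤ ENNReal.ofReal C * seminorm δ G ({x | t < v x}.indicator 1) := by
      intro t ht hreg
      have hopen : IsOpen {x | t < v x} := isOpen_lt continuous_const hv.continuous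
      have hcl : closure {x | t < v x} ⊆ tsupport u :=
        (closure_minimal (fun x hx => le_of_lt hx)
          (isClosed_le continuous_const hv.continuous)).trans (hsupp t ht)
      have hcl' := hcl.trans huG.2
      rw [seminorm_indicator_eq hopen.measurableSet hG.measurableSet (subset_closure.trans hcl'),
        ← mul_assoc, mul_comm _ 2, ← h2C]
      refine H _ hopen ⟨huG.1.isCompact.of_isClosed_subset isClosed_closure hcl, hcl'⟩ ?_
      refine isSmoothHypersurface_frontier_superlevel hn hv ?_
        (frontier_subset_closure.trans hcl')
      -- The level set lies in `tsupport u`, near which `χ = 1`; there `v` is `u` plus a linear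
      -- form, so a critical point of `v` would put `t` in the excluded countable set.
      intro x hx hcrit
      have hxu := hsupp t ht x hx.ge
      have hloc : ∀ᶠ y in 𝓝 x, χ y = 1 := (eventually_nhdsSet_iff_forall.1 hχ1) x hxu
      have heq : v =ᶠ[𝓝 x] fun y => u y + innerSL ℝ a y := by
        filter_upwards [hloc] with y hy
        simp [v, f, hy]
      refine hreg ⟨x, ?_, ?_⟩
      · have hd := ((hu.differentiable (by simp) x).hasFDerivAt.add
          (innerSL ℝ a).hasFDerivAt).congr_of_eventuallyEq heq
        rw [hd.fderiv] at hcrit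
        exact hcrit
      · have := heq.self_of_nhds
        rw [hx] at this
        exact this.symm
    -- Levels above `η` keep the superlevel set of `v` inside `tsupport u`; levels below `s - η`
    -- make it contain `{u ≥ s}`. Hence the length `s - 2η`.
    calc ENNReal.ofReal (s - 2 * η) * volume {x | s ≤ u x} ^ p
        = ∫⁻ t in Set.Ioo η (s - η), volume {x | s ≤ u x} ^ p := by
          rw [setLIntegral_const, Real.volume_Ioo, mul_comm]
          congr 2
          ring
      _ ≤ ∫⁻ t in Set.Ioo η (s - η),
            ENNReal.ofReal C * seminorm δ G ({x | t < v x}.indicator 1) := by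
          refine lintegral_mono_ae ?_
          filter_upwards [ae_restrict_mem measurableSet_Ioo,
            ae_restrict_of_ae (hcount.ae_notMem volume)] with t ht hreg
          refine le_trans ?_ (hlevel t ht.1 hreg)
          refine ENNReal.rpow_le_rpow (measure_mono fun x hx => ?_) hp
          have h1 := neg_abs_le (inner ℝ a (f x))
          have h2 := hfa x
          have h3 := ht.2
          have h4 : s ≤ u x := hx
          change t < u x + inner ℝ a (f x)
          linarith
      _ ≤ ∫⁻ t, ENNReal.ofReal C * seminorm δ G ({x | t < v x}.indicator 1) :=
          setLIntegral_le_lintegral _ _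
      _ = ENNReal.ofReal C * seminorm δ G v := by
          rw [lintegral_const_mul' _ _ ENNReal.ofReal_ne_top,
            seminorm_eq_lintegral_superlevel hv.continuous.measurable]
      _ ≤ _ := by gcongr
  have hη : Tendsto (fun η : ℝ => η) (𝓝[>] 0) (𝓝 0) := tendsto_id.mono_left nhdsWithin_le_nhds
  have hl : Tendsto (fun η : ℝ => ENNReal.ofReal (s - 2 * η) * volume {x | s ≤ u x} ^ p) (𝓝[>] 0)
      (𝓝 (ENNReal.ofReal s * volume {x | s ≤ u x} ^ p)) := by
    refine ENNReal.Tendsto.mul_const (ENNReal.tendsto_ofReal ?_) (Or.inl (by simpa using hs))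
    simpa using (hη.const_mul 2).const_sub s
  have hr : Tendsto (fun η : ℝ => ENNReal.ofReal C * (seminorm δ G u + ENNReal.ofReal η * S))
      (𝓝[>] 0) (𝓝 (ENNReal.ofReal C * seminorm δ G u)) := by
    refine ENNReal.Tendsto.const_mul ?_ (Or.inr ENNReal.ofReal_ne_top)
    have := (ENNReal.Tendsto.mul_const (b := S) (ENNReal.tendsto_ofReal hη)
      (Or.inr hSt.ne)).const_add (seminorm δ G u)
    simpa using this
  exact le_of_tendsto_of_tendsto hl hr (eventually_mem_nhdsWithin.mono fun η hη => claim η hη)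

/-! ### Mollification: from smooth functions to indicators -/

theorem liminf_add_liminf_le (a b : ℕ → ℝ≥0∞) :
    liminf a atTop + liminf b atTop ≤ liminf (fun k => a k + b k) atTop := by
  have mono : ∀ c : ℕ → ℝ≥0∞, Monotone fun m => ⨅ i ≥ m, c i := fun c m m' h =>
    biInf_mono fun i hi => le_trans h hi
  rw [liminf_eq_iSup_iInf_of_nat, liminf_eq_iSup_iInf_of_nat, liminf_eq_iSup_iInf_of_nat,
    ENNReal.iSup_add_iSup_of_monotone (mono a) (mono b)]
  exact iSup_mono fun m => le_iInf₂ fun i hi => add_le_add (iInf₂_le i hi) (iInf₂_le i hi)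

/-- A convolution is a superposition of translates, and the energy over the whole space is
translation invariant. The energy over `G` alone is not. -/
theorem lintegral_lintegral_convolution_le {ρ f : EuclideanSpace ℝ (Fin n) → ℝ}
    (hρ : Continuous ρ) (hρc : HasCompactSupport ρ) (hf : Measurable f)
    (hfl : LocallyIntegrable f) :
    ∫⁻ x, ∫⁻ y, ‖(convolution ρ f (ContinuousLinearMap.lsmul ℝ ℝ) volume) x -
        (convolution ρ f (ContinuousLinearMap.lsmul ℝ ℝ) volume) y‖ₑ * kernel δ (x - y) ≤
      (∫⁻ t, ‖ρ t‖ₑ) * ∫⁻ x, ∫⁻ y, ‖f x - f y‖ₑ * kernel δ (x - y) := by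
  have hex := hρc.convolutionExists_left (ContinuousLinearMap.lsmul ℝ ℝ) hρ hfl
  have hρm := hρ.measurable
  have hpt : ∀ x y, ‖(convolution ρ f (ContinuousLinearMap.lsmul ℝ ℝ) volume) x -
        (convolution ρ f (ContinuousLinearMap.lsmul ℝ ℝ) volume) y‖ₑ ≤
        ∫⁻ t, ‖ρ t‖ₑ * ‖f (x - t) - f (y - t)‖ₑ := by
    intro x y
    rw [convolution, convolution, ← integral_sub (hex x) (hex y)]
    refine (enorm_integral_le_lintegral_enorm _).trans (le_of_eq ?_)
    refine lintegral_congr fun t => ?_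
    simp only [ContinuousLinearMap.lsmul_apply]
    rw [← smul_sub, enorm_smul]
  have hm : Measurable fun q : (EuclideanSpace ℝ (Fin n) × EuclideanSpace ℝ (Fin n)) ×
      EuclideanSpace ℝ (Fin n) =>
      ‖ρ q.1.2‖ₑ * (‖f (q.1.1 - q.1.2) - f (q.2 - q.1.2)‖ₑ * kernel δ (q.1.1 - q.2)) := by
    fun_prop
  calc _ ≤ ∫⁻ x, ∫⁻ y, (∫⁻ t, ‖ρ t‖ₑ * ‖f (x - t) - f (y - t)‖ₑ) * kernel δ (x - y) := by
        gcongr with x y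
        exact hpt x y
    _ = ∫⁻ x, ∫⁻ y, ∫⁻ t, ‖ρ t‖ₑ * (‖f (x - t) - f (y - t)‖ₑ * kernel δ (x - y)) := by
        refine lintegral_congr fun x => lintegral_congr fun y => ?_
        rw [← lintegral_mul_const' _ _ (show kernel δ (x - y) ≠ ⊤ from ENNReal.ofReal_ne_top)]
        simp only [mul_assoc]
    _ = ∫⁻ x, ∫⁻ t, ∫⁻ y, ‖ρ t‖ₑ * (‖f (x - t) - f (y - t)‖ₑ * kernel δ (x - y)) := by
        refine lintegral_congr fun x => ?_
        exact lintegral_lintegral_swap (by fun_prop)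
    _ = ∫⁻ t, ∫⁻ x, ∫⁻ y, ‖ρ t‖ₑ * (‖f (x - t) - f (y - t)‖ₑ * kernel δ (x - y)) :=
        lintegral_lintegral_swap (Measurable.lintegral_prod_right' hm).aemeasurable
    _ = ∫⁻ t, ‖ρ t‖ₑ * ∫⁻ x, ∫⁻ y, ‖f x - f y‖ₑ * kernel δ (x - y) := by
        refine lintegral_congr fun t => ?_
        simp only [lintegral_const_mul' _ _ (enorm_ne_top (x := ρ t))]
        congr 1
        rw [← lintegral_sub_right_eq_self
          (fun x => ∫⁻ y, ‖f x - f y‖ₑ * kernel δ (x - y)) t]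
        refine lintegral_congr fun x => ?_
        rw [← lintegral_sub_right_eq_self (fun y => ‖f (x - t) - f y‖ₑ * kernel δ (x - t - y)) t]
        simp only [sub_sub_sub_cancel_right]
    _ = _ := lintegral_mul_const _ (by fun_prop)

/-- The link between the translation-invariant energy and the one on `G`: the difference is a
weighted `L¹` norm, coming from pairs with one point in `G` and one outside. -/
theorem lintegral_lintegral_eq_seminorm_add (hG : MeasurableSet G)
    {f : EuclideanSpace ℝ (Fin n) → ℝ} (hf : Measurable f) (hfG : ∀ x ∉ G, f x = 0) :
    ∫⁻ x, ∫⁻ y, ‖f x - f y‖ₑ * kernel δ (x - y) =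
      seminorm δ G f + 2 * ∫⁻ x in G, ‖f x‖ₑ * ∫⁻ y in Gᶜ, kernel δ (x - y) := by
  have hm := measurable_enorm_sub_mul_kernel (δ := δ) hf
  have e1 : ∀ x, ∫⁻ y in Gᶜ, ‖f x - f y‖ₑ * kernel δ (x - y) =
      ‖f x‖ₑ * ∫⁻ y in Gᶜ, kernel δ (x - y) := by
    intro x
    rw [← lintegral_const_mul _ (by fun_prop)]
    refine setLIntegral_congr_fun hG.compl fun y hy => ?_
    simp [hfG y hy]
  have e2 : ∫⁻ x in Gᶜ, ∫⁻ y in G, ‖f x - f y‖ₑ * kernel δ (x - y) =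
      ∫⁻ x in G, ‖f x‖ₑ * ∫⁻ y in Gᶜ, kernel δ (x - y) := by
    rw [lintegral_lintegral_swap (f := fun x y => ‖f x - f y‖ₑ * kernel δ (x - y)) hm.aemeasurable]
    refine lintegral_congr fun x => ?_
    rw [← e1]
    refine lintegral_congr fun y => ?_
    rw [enorm_sub_rev, kernel_sub_comm]
  have e3 : ∫⁻ x in Gᶜ, ∫⁻ y in Gᶜ, ‖f x - f y‖ₑ * kernel δ (x - y) = 0 := by
    simp only [e1]
    rw [setLIntegral_congr_fun (g := 0) hG.compl]
    · simp
    · intro x hx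
      simp [hfG x hx]
  have hin : ∀ x, ∫⁻ y, ‖f x - f y‖ₑ * kernel δ (x - y) =
      (∫⁻ y in G, ‖f x - f y‖ₑ * kernel δ (x - y)) +
        ∫⁻ y in Gᶜ, ‖f x - f y‖ₑ * kernel δ (x - y) := fun x =>
    (lintegral_add_compl _ hG).symm
  rw [← lintegral_add_compl _ hG]
  simp only [hin]
  rw [lintegral_add_left (Measurable.lintegral_prod_right' hm),
    lintegral_add_left (Measurable.lintegral_prod_right' hm), e2, e3, seminorm_eq]
  simp only [e1]
  ring

theorem lintegral_compl_kernel_lt_top (hn : 2 ≤ n) (hδ : 0 < δ) (hG : IsOpen G)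
    {K : Set (EuclideanSpace ℝ (Fin n))} (hK : IsCompact K) (hKG : K ⊆ G) :
    ∫⁻ x in K, ∫⁻ y in Gᶜ, kernel δ (x - y) < ⊤ := by
  obtain ⟨d, hd, hdG⟩ := hK.exists_thickening_subset_open hG hKG
  have hI := lintegral_kernel_compl_ball_lt_top hn hδ hd
  have hle : ∀ x ∈ K, ∫⁻ y in Gᶜ, kernel δ (x - y) ≤
      ∫⁻ z in (Metric.ball (0 : EuclideanSpace ℝ (Fin n)) d)ᶜ, kernel δ z := by
    intro x hx
    rw [← lintegral_indicator hG.measurableSet.compl,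
      ← lintegral_indicator Metric.isOpen_ball.measurableSet.compl,
      ← lintegral_sub_left_eq_self (Set.indicator _ (kernel δ)) x]
    refine lintegral_mono fun y => ?_
    by_cases hy : y ∈ G
    · simp [hy]
    · have : x - y ∈ (Metric.ball (0 : EuclideanSpace ℝ (Fin n)) d)ᶜ := by
        intro h
        refine hy (hdG (Metric.mem_thickening_iff.2 ⟨x, hx, ?_⟩))
        rwa [mem_ball_zero_iff, ← dist_eq_norm, dist_comm] at h
      rw [Set.indicator_of_mem this, Set.indicator_of_mem (Set.mem_compl hy)]
  calc ∫⁻ x in K, ∫⁻ y in Gᶜ, kernel δ (x - y)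
      ≤ ∫⁻ x in K, ∫⁻ z in (Metric.ball (0 : EuclideanSpace ℝ (Fin n)) d)ᶜ, kernel δ z :=
        setLIntegral_mono' hK.measurableSet hle
    _ < ⊤ := by
        rw [setLIntegral_const]
        exact ENNReal.mul_lt_top hI hK.measure_lt_top

theorem compactSupportIn_convolution {ρ f : EuclideanSpace ℝ (Fin n) → ℝ}
    {K : Set (EuclideanSpace ℝ (Fin n))} {r : ℝ} (hK : IsCompact K)
    (hKG : Metric.cthickening r K ⊆ G) (hρ : Function.support ρ ⊆ Metric.ball 0 r)
    (hf : Function.support f ⊆ K) :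
    CompactSupportIn G (convolution ρ f (ContinuousLinearMap.lsmul ℝ ℝ) volume) := by
  have hsupp : tsupport (convolution ρ f (ContinuousLinearMap.lsmul ℝ ℝ) volume) ⊆
      Metric.cthickening r K := by
    refine closure_minimal ?_ Metric.isClosed_cthickening
    intro x hx
    obtain ⟨z, hz, y, hy, rfl⟩ := support_convolution_subset _ hx
    refine Metric.thickening_subset_cthickening _ _
      (Metric.mem_thickening_iff.2 ⟨y, hf hy, ?_⟩)
    simpa [dist_eq_norm] using hρ hz
  exact ⟨hK.cthickening.of_isClosed_subset (isClosed_tsupport _) hsupp, hsupp.trans hKG⟩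

/-- Mollification does not increase the energy over the whole space, and the exterior term `T` is
lower semicontinuous by Fatou. As `T f` is finite, it can be subtracted, which leaves the inequality
on `G` without loss in the constant. -/
theorem indicator_inequality_of_weak_type (hn : 2 ≤ n) (hδ0 : 0 < δ) (hG : IsOpen G)
    {p C : ℝ} (hp : 0 ≤ p)
    (W : ∀ u : EuclideanSpace ℝ (Fin n) → ℝ, ContDiff ℝ ∞ u → CompactSupportIn G u →
      ∀ s : ℝ, 0 < s →
        ENNReal.ofReal s * volume {x | s ≤ u x} ^ p ≤ ENNReal.ofReal C * seminorm δ G u)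
    {A K : Set (EuclideanSpace ℝ (Fin n))} (hA : MeasurableSet A) (hAK : A ⊆ K)
    (hK : IsCompact K) (hKG : K ⊆ G) :
    volume A ^ p ≤ ENNReal.ofReal C * seminorm δ G (A.indicator 1) := by
  set f : EuclideanSpace ℝ (Fin n) → ℝ := A.indicator 1 with hfdef
  have hf : Measurable f := measurable_one.indicator hA
  have hfK : Function.support f ⊆ K := Set.support_indicator_subset.trans hAK
  have hfi : Integrable f := by
    refine (integrable_indicator_iff hA).2 ?_
    exact integrableOn_const ((measure_mono hAK).trans_lt hK.measure_lt_top).ne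
  let φ : ℕ → ContDiffBump (0 : EuclideanSpace ℝ (Fin n)) := fun k =>
    { rIn := 1 / (k + 1)
      rOut := 2 * (1 / (k + 1))
      rIn_pos := by positivity
      rIn_lt_rOut := by
        have : (0 : ℝ) < 1 / (k + 1) := by positivity
        linarith }
  have hφ0 : Tendsto (fun k => (φ k).rOut) atTop (𝓝 0) := by
    have := (tendsto_one_div_add_atTop_nhds_zero_nat (𝕜 := ℝ)).const_mul 2
    rwa [mul_zero] at this
  let u : ℕ → EuclideanSpace ℝ (Fin n) → ℝ := fun k =>
    convolution ((φ k).normed volume) f (ContinuousLinearMap.lsmul ℝ ℝ) volume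
  have hconv : ∀ᵐ x, Tendsto (fun k => u k x) atTop (𝓝 (f x)) :=
    ContDiffBump.ae_convolution_tendsto_right_of_locallyIntegrable (K := 2) hφ0
      (Eventually.of_forall fun k => le_rfl) hfi.locallyIntegrable
  have husm : ∀ k, ContDiff ℝ ∞ (u k) := fun k =>
    (φ k).hasCompactSupport_normed.contDiff_convolution_left _ (φ k).contDiff_normed
      hfi.locallyIntegrable
  obtain ⟨r, hr, hrG⟩ := hK.exists_cthickening_subset_open hG hKG
  have husupp : ∀ᶠ k in atTop, CompactSupportIn G (u k) := by
    filter_upwards [hφ0.eventually_lt_const hr] with k hk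
    refine compactSupportIn_convolution hK hrG ?_ hfK
    rw [(φ k).support_normed_eq]
    exact Metric.ball_subset_ball hk.le
  have henergy : ∀ k, ∫⁻ x, ∫⁻ y, ‖u k x - u k y‖ₑ * kernel δ (x - y) ≤
      ∫⁻ x, ∫⁻ y, ‖f x - f y‖ₑ * kernel δ (x - y) := by
    intro k
    refine (lintegral_lintegral_convolution_le (φ k).continuous_normed
      (φ k).hasCompactSupport_normed hf hfi.locallyIntegrable).trans (le_of_eq ?_)
    have : ∫⁻ t, ‖(φ k).normed volume t‖ₑ = 1 := by
      rw [← ofReal_integral_norm_eq_lintegral_enorm (φ k).integrable_normed]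
      simp only [Real.norm_of_nonneg ((φ k).nonneg_normed _), (φ k).integral_normed,
        ENNReal.ofReal_one]
    rw [this, one_mul]
  let T : (EuclideanSpace ℝ (Fin n) → ℝ) → ℝ≥0∞ := fun w =>
    ∫⁻ x in G, ‖w x‖ₑ * ∫⁻ y in Gᶜ, kernel δ (x - y)
  have hκ : Measurable fun x : EuclideanSpace ℝ (Fin n) => ∫⁻ y in Gᶜ, kernel δ (x - y) :=
    Measurable.lintegral_prod_right' (f := fun p : _ × _ => kernel δ (p.1 - p.2)) (by fun_prop)
  have hTf : T f ≠ ⊤ := by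
    refine (lt_of_le_of_lt ?_ (lintegral_compl_kernel_lt_top hn hδ0 hG hK hKG)).ne
    rw [← lintegral_indicator hK.measurableSet]
    refine (setLIntegral_le_lintegral _ _).trans (lintegral_mono fun x => ?_)
    by_cases hx : x ∈ A
    · simp [hfdef, hx, hAK hx]
    · simp [hfdef, hx]
  have hTlim : T f ≤ liminf (fun k => T (u k)) atTop := by
    refine le_trans (lintegral_mono_ae ?_) (lintegral_liminf_le fun k => ?_)
    · filter_upwards [ae_restrict_of_ae hconv] with x hx
      -- Where `f x ≠ 0` the product converges whatever the value of the weight, so no finiteness of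
      -- the weight is needed.
      by_cases hx0 : f x = 0
      · simp [hx0]
      · exact (ENNReal.Tendsto.mul_const hx.enorm (Or.inl (by simpa using hx0))).liminf_eq.ge
    · exact (husm k).continuous.measurable.enorm.mul hκ
  have hvol : ∀ s : ℝ, s < 1 → volume A ≤ liminf (fun k => volume {x | s ≤ u k x}) atTop := by
    intro s hs
    have hmeas : ∀ k, MeasurableSet {x | s ≤ u k x} := fun k =>
      measurableSet_le measurable_const (husm k).continuous.measurable
    simp only [← lintegral_indicator_one hA, ← fun k => lintegral_indicator_one (μ := volume) (hmeas k)]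
    refine le_trans (lintegral_mono_ae ?_)
      (lintegral_liminf_le fun k => measurable_one.indicator (hmeas k))
    filter_upwards [hconv] with x hx
    by_cases hxA : x ∈ A
    · have h1 : f x = 1 := by simp [hfdef, hxA]
      rw [h1] at hx
      have : ∀ᶠ k in atTop, Set.indicator {x | s ≤ u k x}
          (1 : EuclideanSpace ℝ (Fin n) → ℝ≥0∞) x = 1 := by
        filter_upwards [hx.eventually_const_lt hs] with k hk
        exact Set.indicator_of_mem (show x ∈ {x | s ≤ u k x} from le_of_lt hk) _
      rw [Set.indicator_of_mem hxA, liminf_congr this]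
      simp
    · simp [hxA]
  have main : ∀ s : ℝ, 0 < s → s < 1 →
      ENNReal.ofReal s * volume A ^ p ≤ ENNReal.ofReal C * seminorm δ G f := by
    intro s hs0 hs1
    have hmono : Monotone fun t : ℝ≥0∞ => ENNReal.ofReal s * t ^ p := fun a b hab => by
      simp only
      gcongr
    have hcont : Continuous fun t : ℝ≥0∞ => ENNReal.ofReal s * t ^ p :=
      (ENNReal.continuous_const_mul ENNReal.ofReal_ne_top).comp ENNReal.continuous_rpow_const
    have hN : ENNReal.ofReal s * volume A ^ p ≤
        liminf (fun k => ENNReal.ofReal s * volume {x | s ≤ u k x} ^ p) atTop :=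
      (hmono (hvol s hs1)).trans (hmono.map_liminf_of_continuousAt _ hcont.continuousAt).le
    have hmonoT : Monotone fun t : ℝ≥0∞ => ENNReal.ofReal C * (2 * t) := fun a b hab => by
      simp only
      gcongr
    have hcontT : Continuous fun t : ℝ≥0∞ => ENNReal.ofReal C * (2 * t) :=
      (ENNReal.continuous_const_mul ENNReal.ofReal_ne_top).comp
        (ENNReal.continuous_const_mul (by simp))
    have hT : ENNReal.ofReal C * (2 * T f) ≤
        liminf (fun k => ENNReal.ofReal C * (2 * T (u k))) atTop :=
      (hmonoT hTlim).trans (hmonoT.map_liminf_of_continuousAt _ hcontT.continuousAt).le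
    have hfin : ENNReal.ofReal C * (2 * T f) ≠ ⊤ :=
      ENNReal.mul_ne_top ENNReal.ofReal_ne_top (ENNReal.mul_ne_top (by simp) hTf)
    -- Add the finite exterior term to both sides, so that the whole-space energy estimate applies.
    refine (ENNReal.add_le_add_iff_right hfin).1 ?_
    refine (add_le_add hN hT).trans ((liminf_add_liminf_le _ _).trans ?_)
    refine liminf_le_of_frequently_le' (Eventually.frequently ?_)
    filter_upwards [husupp] with k hk
    have hfG : ∀ x ∉ G, f x = 0 := fun x hx => by
      by_contra h
      exact hx (hKG (hfK h))
    have hu0 : ∀ x ∉ G, u k x = 0 := fun x hx =>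
      image_eq_zero_of_notMem_tsupport fun h => hx (hk.2 h)
    have := henergy k
    rw [lintegral_lintegral_eq_seminorm_add hG.measurableSet hf hfG,
      lintegral_lintegral_eq_seminorm_add hG.measurableSet (husm k).continuous.measurable hu0] at this
    calc _ ≤ ENNReal.ofReal C * seminorm δ G (u k) + ENNReal.ofReal C * (2 * T (u k)) := by
          refine add_le_add_left ?_ _
          exact W (u k) (husm k) hk s hs0
      _ = ENNReal.ofReal C * (seminorm δ G (u k) + 2 * T (u k)) := by rw [mul_add]
      _ ≤ ENNReal.ofReal C * (seminorm δ G f + 2 * T f) := by gcongr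
      _ = _ := by rw [mul_add]
  have hl : Tendsto (fun s : ℝ => ENNReal.ofReal s * volume A ^ p) (𝓝[<] 1)
      (𝓝 (ENNReal.ofReal 1 * volume A ^ p)) :=
    ENNReal.Tendsto.mul_const (ENNReal.tendsto_ofReal nhdsWithin_le_nhds) (Or.inl (by simp))
  rw [ENNReal.ofReal_one, one_mul] at hl
  refine le_of_tendsto hl ?_
  filter_upwards [Ioo_mem_nhdsLT (zero_lt_one' ℝ)] with s hs
  exact main s hs.1 hs.2

/-! ### Minkowski's inequality for the layer cake, and the Sobolev inequality -/

/-- Write `v^q = ∫ 1_{t < v} v^(q-1) dt` and apply Hölder for each `t`: this gives `I ≤ J * I^(1 -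
1/q)`. Dividing requires `I` finite. -/
theorem rpow_lintegral_rpow_le_of_ne_top {α : Type*} [MeasurableSpace α] {μ : Measure α}
    [SFinite μ] {v : α → ℝ} (hv : Measurable v) {q : ℝ} (hq : 1 ≤ q)
    (hfin : ∫⁻ x, ENNReal.ofReal (v x) ^ q ∂μ ≠ ⊤) :
    (∫⁻ x, ENNReal.ofReal (v x) ^ q ∂μ) ^ (1 / q) ≤
      ∫⁻ t in Set.Ioi (0 : ℝ), μ {x | t < v x} ^ (1 / q) := by
  have hq0 : 0 < q := by linarith
  set I := ∫⁻ x, ENNReal.ofReal (v x) ^ q ∂μ with hI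
  set J := ∫⁻ t in Set.Ioi (0 : ℝ), μ {x | t < v x} ^ (1 / q)
  by_cases hI0 : I = 0
  · rw [hI0, ENNReal.zero_rpow_of_pos (by positivity)]
    exact zero_le
  have hr : 0 ≤ 1 - 1 / q := by
    rw [sub_nonneg, div_le_one hq0]
    exact hq
  have hlayer : ∀ x, ENNReal.ofReal (v x) ^ q =
      ∫⁻ t in Set.Ioi (0 : ℝ), (if t < v x then 1 else 0) * ENNReal.ofReal (v x) ^ (q - 1) := by
    intro x
    rw [lintegral_mul_const _ (Measurable.ite measurableSet_Iio measurable_const measurable_const)]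
    have h1 : ∫⁻ t in Set.Ioi (0 : ℝ), (if t < v x then 1 else 0 : ℝ≥0∞) = ENNReal.ofReal (v x) := by
      have : (fun t => (if t < v x then 1 else 0 : ℝ≥0∞)) = (Set.Iio (v x)).indicator 1 := by
        ext t
        simp [Set.indicator]
      rw [this, lintegral_indicator_one measurableSet_Iio, Measure.restrict_apply measurableSet_Iio,
        Set.Iio_inter_Ioi, Real.volume_Ioo, sub_zero]
    rw [h1]
    by_cases h0 : ENNReal.ofReal (v x) = 0
    · rw [h0, zero_mul, ENNReal.zero_rpow_of_pos hq0]
    · nth_rewrite 2 [← ENNReal.rpow_one (ENNReal.ofReal (v x))]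
      rw [← ENNReal.rpow_add _ _ h0 ENNReal.ofReal_ne_top]
      congr 1
      ring
  have hset : ∀ t, MeasurableSet {x | t < v x} := fun t => measurableSet_lt measurable_const hv
  have hle : I ≤ J * I ^ (1 - 1 / q) := by
    calc I = ∫⁻ x, (∫⁻ t in Set.Ioi (0 : ℝ),
            (if t < v x then 1 else 0) * ENNReal.ofReal (v x) ^ (q - 1)) ∂μ := by
          rw [hI]
          exact lintegral_congr hlayer
      _ = ∫⁻ t in Set.Ioi (0 : ℝ), ∫⁻ x,
            (if t < v x then 1 else 0) * ENNReal.ofReal (v x) ^ (q - 1) ∂μ := by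
          refine lintegral_lintegral_swap (Measurable.aemeasurable ?_)
          refine Measurable.mul (Measurable.ite (measurableSet_lt (by fun_prop) (by fun_prop))
            measurable_const measurable_const) (by fun_prop)
      _ ≤ ∫⁻ t in Set.Ioi (0 : ℝ), μ {x | t < v x} ^ (1 / q) * I ^ (1 - 1 / q) := by
          refine lintegral_mono fun t => ?_
          have := ENNReal.lintegral_mul_norm_pow_le (μ := μ)
            (f := {x | t < v x}.indicator 1) (g := fun x => ENNReal.ofReal (v x) ^ q)
            (measurable_one.indicator (hset t)).aemeasurable (by fun_prop)
            (by positivity : 0 ≤ 1 / q) hr (by ring)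
          rw [lintegral_indicator_one (hset t)] at this
          refine le_trans (le_of_eq (lintegral_congr fun x => ?_)) this
          rw [← ENNReal.rpow_mul]
          congr 1
          · by_cases hx : t < v x
            · simp [hx]
            · simp [hx, hq0]
          · congr 1
            field_simp
      _ = J * I ^ (1 - 1 / q) :=
          lintegral_mul_const' _ _ (ENNReal.rpow_ne_top_of_nonneg hr hfin)
  have hsplit : I = I ^ (1 / q) * I ^ (1 - 1 / q) := by
    rw [← ENNReal.rpow_add _ _ hI0 hfin, add_sub_cancel, ENNReal.rpow_one]
  have hne0 : I ^ (1 - 1 / q) ≠ 0 := (ENNReal.rpow_pos (pos_iff_ne_zero.2 hI0) hfin).ne'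
  have hnet : I ^ (1 - 1 / q) ≠ ⊤ := ENNReal.rpow_ne_top_of_nonneg hr hfin
  refine (ENNReal.mul_le_mul_iff_left hne0 hnet).1 ?_
  rwa [← hsplit]

/-- Minkowski's integral inequality for the layer cake decomposition of a function. -/
theorem rpow_lintegral_rpow_le {α : Type*} [MeasurableSpace α] {μ : Measure α}
    [SFinite μ] {v : α → ℝ} (hv : Measurable v) {q : ℝ} (hq : 1 ≤ q) (hfin : μ {x | 0 < v x} ≠ ⊤) :
    (∫⁻ x, ENNReal.ofReal (v x) ^ q ∂μ) ^ (1 / q) ≤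
      ∫⁻ t in Set.Ioi (0 : ℝ), μ {x | t < v x} ^ (1 / q) := by
  have hq0 : 0 < q := by linarith
  set J := ∫⁻ t in Set.Ioi (0 : ℝ), μ {x | t < v x} ^ (1 / q)
  -- The truncations have finite integral, being bounded and positive only on a set of finite
  -- measure; Fatou removes the truncation.
  have htrunc : ∀ N : ℕ, ∫⁻ x, ENNReal.ofReal (min (v x) N) ^ q ∂μ ≤ J ^ q := by
    intro N
    have hNfin : ∫⁻ x, ENNReal.ofReal (min (v x) N) ^ q ∂μ ≠ ⊤ := by
      have : ∫⁻ x, ENNReal.ofReal (min (v x) N) ^ q ∂μ ≤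
          ∫⁻ x in {x | 0 < v x}, ENNReal.ofReal N ^ q ∂μ := by
        rw [← lintegral_indicator (measurableSet_lt measurable_const hv)]
        refine lintegral_mono fun x => ?_
        by_cases hx : 0 < v x
        · rw [Set.indicator_of_mem (show x ∈ {x | 0 < v x} from hx)]
          gcongr
          exact min_le_right _ _
        · rw [ENNReal.ofReal_of_nonpos ((min_le_left _ _).trans (not_lt.1 hx)),
            ENNReal.zero_rpow_of_pos hq0]
          exact zero_le
      refine ne_top_of_le_ne_top ?_ this
      rw [setLIntegral_const]
      exact ENNReal.mul_ne_top (ENNReal.rpow_ne_top_of_nonneg hq0.le ENNReal.ofReal_ne_top) hfin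
    have h1 := rpow_lintegral_rpow_le_of_ne_top (hv.min measurable_const) hq hNfin
    have h2 : ∫⁻ t in Set.Ioi (0 : ℝ), μ {x | t < min (v x) N} ^ (1 / q) ≤ J := by
      refine lintegral_mono fun t => ENNReal.rpow_le_rpow (measure_mono fun x hx => ?_)
        (by positivity)
      exact lt_of_lt_of_le (show t < min (v x) N from hx) (min_le_left _ _)
    rw [← ENNReal.rpow_inv_le_iff hq0, ← one_div]
    exact h1.trans h2
  rw [one_div, ENNReal.rpow_inv_le_iff hq0]
  have hlim : ∀ x, liminf (fun N : ℕ => ENNReal.ofReal (min (v x) N) ^ q) atTop =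
      ENNReal.ofReal (v x) ^ q := by
    intro x
    refine Tendsto.liminf_eq (tendsto_const_nhds.congr' ?_)
    filter_upwards [eventually_ge_atTop ⌈v x⌉₊] with N hN
    rw [min_eq_left (Nat.ceil_le.1 hN)]
  calc ∫⁻ x, ENNReal.ofReal (v x) ^ q ∂μ
      = ∫⁻ x, liminf (fun N : ℕ => ENNReal.ofReal (min (v x) N) ^ q) atTop ∂μ := by
        simp only [hlim]
    _ ≤ liminf (fun N : ℕ => ∫⁻ x, ENNReal.ofReal (min (v x) N) ^ q ∂μ) atTop :=
        lintegral_liminf_le fun N => by fun_prop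
    _ ≤ J ^ q := liminf_le_of_frequently_le' (Eventually.frequently (Eventually.of_forall htrunc))

theorem sobolev_of_indicator_inequality {q C : ℝ} (hq : 1 ≤ q)
    (H : ∀ A K : Set (EuclideanSpace ℝ (Fin n)), MeasurableSet A → A ⊆ K → IsCompact K → K ⊆ G →
      volume A ^ (1 / q) ≤ ENNReal.ofReal C * seminorm δ G (A.indicator 1))
    {u : EuclideanSpace ℝ (Fin n) → ℝ} (hu : AEMeasurable u) (huG : CompactSupportIn G u) :
    (∫⁻ x in G, ENNReal.ofReal (|u x| ^ q)) ^ (1 / q) ≤ ENNReal.ofReal C * seminorm δ G u := by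
  have hS : MeasurableSet (tsupport u) := (isClosed_tsupport u).measurableSet
  -- A measurable representative of `|u|` that vanishes everywhere off `tsupport u`, so that its
  -- superlevel sets at levels `t ≥ 0` lie in that compact set.
  set w : EuclideanSpace ℝ (Fin n) → ℝ := (tsupport u).indicator fun x => |hu.mk u x| with hwdef
  have hw : Measurable w := hu.measurable_mk.abs.indicator hS
  have hwu : w =ᵐ[volume] fun x => |u x| := by
    filter_upwards [hu.ae_eq_mk] with x hx
    by_cases hxS : x ∈ tsupport u
    · simp [hwdef, hxS, hx]
    · simp [hwdef, hxS, image_eq_zero_of_notMem_tsupport hxS]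
  have hsub : ∀ t : ℝ, 0 ≤ t → {x | t < w x} ⊆ tsupport u := by
    intro t ht x hx
    by_contra hxS
    have hx : t < w x := hx
    simp only [hwdef, Set.indicator_of_notMem hxS] at hx
    linarith
  calc (∫⁻ x in G, ENNReal.ofReal (|u x| ^ q)) ^ (1 / q)
      ≤ (∫⁻ x, ENNReal.ofReal (w x) ^ q) ^ (1 / q) := by
        refine ENNReal.rpow_le_rpow ((setLIntegral_le_lintegral _ _).trans (le_of_eq ?_))
          (by positivity)
        refine lintegral_congr_ae ?_
        filter_upwards [hwu] with x hx
        rw [hx, ENNReal.ofReal_rpow_of_nonneg (abs_nonneg _) (by linarith)]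
    _ ≤ ∫⁻ t in Set.Ioi (0 : ℝ), volume {x | t < w x} ^ (1 / q) :=
        rpow_lintegral_rpow_le hw hq
          ((measure_mono (hsub 0 le_rfl)).trans_lt huG.1.isCompact.measure_lt_top).ne
    _ ≤ ∫⁻ t in Set.Ioi (0 : ℝ), ENNReal.ofReal C * seminorm δ G ({x | t < w x}.indicator 1) :=
        setLIntegral_mono' measurableSet_Ioi fun t ht =>
          H _ _ (measurableSet_lt measurable_const hw) (hsub t (le_of_lt ht)) huG.1.isCompact huG.2
    _ ≤ ∫⁻ t, ENNReal.ofReal C * seminorm δ G ({x | t < w x}.indicator 1) :=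
        setLIntegral_le_lintegral _ _
    _ = ENNReal.ofReal C * seminorm δ G fun x => |u x| := by
        rw [lintegral_const_mul' _ _ ENNReal.ofReal_ne_top, ← seminorm_eq_lintegral_superlevel hw,
          seminorm_congr_ae hwu]
    _ ≤ ENNReal.ofReal C * seminorm δ G u := by
        gcongr
        exact seminorm_mono fun x y => abs_abs_sub_abs_le _ _

/-! ### Capacity, and the equivalence -/

theorem volume_le_lintegral_rpow {K : Set (EuclideanSpace ℝ (Fin n))} (hK : MeasurableSet K)
    (hKG : K ⊆ G) {u : EuclideanSpace ℝ (Fin n) → ℝ} (hu : ∀ x ∈ K, 1 ≤ u x) {q : ℝ}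
    (hq : 0 ≤ q) : volume K ≤ ∫⁻ x in G, ENNReal.ofReal (|u x| ^ q) := by
  calc volume K = ∫⁻ x in K, 1 := by simp
    _ ≤ ∫⁻ x in K, ENNReal.ofReal (|u x| ^ q) := by
        refine setLIntegral_mono' hK fun x hx => ?_
        rw [ENNReal.one_le_ofReal]
        exact Real.one_le_rpow ((hu x hx).trans (le_abs_self _)) hq
    _ ≤ ∫⁻ x in G, ENNReal.ofReal (|u x| ^ q) := lintegral_mono_set hKG

/-- The function `u / s` is admissible for the capacity of the compact set `{u ≥ s}`. -/
theorem weak_type_of_capacity_inequality {p C : ℝ}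
    (H : ∀ K : Set (EuclideanSpace ℝ (Fin n)), IsCompact K → K ⊆ G →
      volume K ^ p ≤ ENNReal.ofReal C * capacity δ K G)
    {u : EuclideanSpace ℝ (Fin n) → ℝ} (hu : Continuous u) (huG : CompactSupportIn G u)
    {s : ℝ} (hs : 0 < s) :
    ENNReal.ofReal s * volume {x | s ≤ u x} ^ p ≤ ENNReal.ofReal C * seminorm δ G u := by
  have hsub : {x | s ≤ u x} ⊆ tsupport u := by
    intro x hx
    by_contra hxS
    have hx : s ≤ u x := hx
    rw [image_eq_zero_of_notMem_tsupport hxS] at hx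
    linarith
  have hK : IsCompact {x | s ≤ u x} :=
    huG.1.isCompact.of_isClosed_subset (isClosed_le continuous_const hu) hsub
  have hts : tsupport (fun x => s⁻¹ * u x) ⊆ tsupport u :=
    closure_mono fun x hx hx0 => hx (by simp [hx0])
  have hcap : capacity δ {x | s ≤ u x} G ≤ ‖s⁻¹‖ₑ * seminorm δ G u := by
    rw [← seminorm_const_mul hu.measurable]
    refine iInf₂_le (fun x => s⁻¹ * u x) ⟨by fun_prop, ⟨huG.1.mul_left, hts.trans huG.2⟩, ?_⟩
    intro x hx
    have hx : s ≤ u x := hx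
    simp only
    rwa [← div_eq_inv_mul, one_le_div hs]
  calc ENNReal.ofReal s * volume {x | s ≤ u x} ^ p
      ≤ ENNReal.ofReal s * (ENNReal.ofReal C * (‖s⁻¹‖ₑ * seminorm δ G u)) := by
        gcongr
        exact (H _ hK (hsub.trans huG.2)).trans (by gcongr)
    _ = (ENNReal.ofReal s * ‖s⁻¹‖ₑ) * (ENNReal.ofReal C * seminorm δ G u) := by ring
    _ = _ := by
        rw [Real.enorm_eq_ofReal (inv_nonneg.2 hs.le), ← ENNReal.ofReal_mul hs.le,
          mul_inv_cancel₀ hs.ne', ENNReal.ofReal_one, one_mul]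

end FracSobolev

theorem theorem4p1 (n : ℕ) (hn : 2 ≤ n) (G : Set (EuclideanSpace ℝ (Fin n))) (hG : IsOpen G)
    (q δ C : ℝ) (hq : 1 ≤ q) (hδ0 : 0 < δ) (hδ1 : δ < 1) (hC : 0 < C) :
    List.TFAE [
      ∀ u : EuclideanSpace ℝ (Fin n) → ℝ, AEMeasurable u volume → FracSobolev.CompactSupportIn G u →
        (∫⁻ x in G, ENNReal.ofReal (|u x| ^ q)) ^ (1 / q) ≤
          ENNReal.ofReal C * FracSobolev.seminorm δ G u,
      ∀ K : Set (EuclideanSpace ℝ (Fin n)), IsCompact K → K ⊆ G →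
        volume K ^ (1 / q) ≤ ENNReal.ofReal C * FracSobolev.capacity δ K G,
      ∀ D : Set (EuclideanSpace ℝ (Fin n)), IsOpen D → FracSobolev.CompactlyContained D G →
        FracSobolev.IsSmoothHypersurface (frontier D) G →
          volume D ^ (1 / q) ≤ ENNReal.ofReal (2 * C) * FracSobolev.perimeter δ D G] := by
  have hq0 : 0 ≤ q := by linarith
  have hp : 0 ≤ 1 / q := by positivity
  have hC0 : ENNReal.ofReal C ≠ 0 := by simpa using hC
  tfae_have 1 → 2 := by
    intro H K hK hKG
    -- The inner infimum is `⊤` for inadmissible `u`, so moving the constant inside relies on `C ≠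
    -- 0`.
    rw [FracSobolev.capacity, ENNReal.mul_iInf_of_ne hC0 ENNReal.ofReal_ne_top]
    refine le_iInf fun u => ?_
    rw [ENNReal.mul_iInf_of_ne hC0 ENNReal.ofReal_ne_top]
    refine le_iInf fun hu => ?_
    refine le_trans ?_ (H u hu.1.measurable.aemeasurable hu.2.1)
    exact ENNReal.rpow_le_rpow
      (FracSobolev.volume_le_lintegral_rpow hK.measurableSet hKG hu.2.2 hq0) hp
  tfae_have 1 → 3 := by
    intro H D hD hDG _
    have hDG' : D ⊆ G := subset_closure.trans hDG.2
    have hts : tsupport (D.indicator (1 : EuclideanSpace ℝ (Fin n) → ℝ)) ⊆ closure D :=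
      closure_mono Set.support_indicator_subset
    have h1 := H (D.indicator 1) (measurable_one.indicator hD.measurableSet).aemeasurable
      ⟨hDG.1.of_isClosed_subset (isClosed_tsupport _) hts, hts.trans hDG.2⟩
    rw [FracSobolev.seminorm_indicator_eq hD.measurableSet hG.measurableSet hDG', ← mul_assoc,
      mul_comm (ENNReal.ofReal C)] at h1
    rw [ENNReal.ofReal_mul zero_le_two, ENNReal.ofReal_ofNat]
    refine le_trans (ENNReal.rpow_le_rpow ?_ hp) h1
    exact FracSobolev.volume_le_lintegral_rpow hD.measurableSet hDG' (fun x hx => by simp [hx]) hq0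
  tfae_have 2 → 1 := by
    intro H u hu huG
    refine FracSobolev.sobolev_of_indicator_inequality hq (fun A K hA hAK hK hKG => ?_) hu huG
    exact FracSobolev.indicator_inequality_of_weak_type hn hδ0 hG hp
      (fun w hw hwG s hs => FracSobolev.weak_type_of_capacity_inequality H hw.continuous hwG hs)
      hA hAK hK hKG
  tfae_have 3 → 1 := by
    intro H u hu huG
    refine FracSobolev.sobolev_of_indicator_inequality hq (fun A K hA hAK hK hKG => ?_) hu huG
    exact FracSobolev.indicator_inequality_of_weak_type hn hδ0 hG hp
      (fun w hw hwG s hs => FracSobolev.weak_type_of_isoperimetric hn hδ0 hδ1 hG hp H hw hwG hs)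
      hA hAK hK hKG
  tfae_finish
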